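/- Let $\mathscr P\subset\mathbb H^n$ be a compact convex right-angled polytope, i.e. a compact set with non-empty interior that is a finite intersection of closed half-spaces and in which any two facets meeting in a face of codimension two are orthogonal. For a facet $F$ let $r_F\in\mathrm{Isom}(\mathbb H^n)$ be the reflection in the hyperplane containing $F$, and let $\Gamma<\mathrm{Isom}(\mathbb H^n)$ be the group generated by all the $r_F$. Let $V$ be a finite-dimensional vector space over $\mathbb F_2$ and let $\lambda$ be a $V$-colouring of $\mathscr P$, i.e. an assignment of a vector $\lambda_F\in V$ to each facet $F$ such that at every vertex $v$ of $\mathscr P$ the vectors assigned to the facets containing $v$ are linearly independent. Then there is a unique group homomorphism $\lambda\colon\Gamma\to V$ with $\lambda(r_F)=\lambda_F$ for every facet $F$, and its kernel $\Gamma_\lambda=\ker\lambda$ is torsion-free. Moreover the orbifold $M_\lambda=\mathbb H^n/\Gamma_\lambda$ is a manifold: $\Gamma_\lambda$ acts properly discontinuously and freely on $\mathbb H^n$, the quotient map $\mathbb H^n\to M_\lambda$ is a regular covering with group $\Gamma_\lambda$, and $M_\lambda$ is a Hausdorff, second countable space carrying a smooth $n$-manifold structure for which the quotient map is a local diffeomorphism.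 -/

import Mathlib

open scoped Manifold ContDiff

noncomputable section

/-- The Lorentzian vector space `ℝ^{n,1}`, written as (space part, time part). -/
abbrev Lorentz (n : ℕ) : Type := EuclideanSpace ℝ (Fin n) × ℝ

/-- The Lorentzian bilinear form of signature `(n, 1)`. -/
def lform {n : ℕ} (x y : Lorentz n) : ℝ := inner ℝ x.1 y.1 - x.2 * y.2

theorem lform_comm {n : ℕ} (x y : Lorentz n) : lform x y = lform y x := by
  simp only [lform, real_inner_comm, mul_comm]

theorem lform_add_left {n : ℕ} (x y z : Lorentz n) :
    lform (x + y) z = lform x z + lform y z := by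
  simp only [lform, Prod.fst_add, Prod.snd_add, inner_add_left]; ring

theorem lform_smul_left {n : ℕ} (a : ℝ) (x z : Lorentz n) :
    lform (a • x) z = a * lform x z := by
  simp only [lform, Prod.smul_fst, Prod.smul_snd, real_inner_smul_left, smul_eq_mul]; ring

theorem lform_sub_left {n : ℕ} (x y z : Lorentz n) :
    lform (x - y) z = lform x z - lform y z := by
  simp only [lform, Prod.fst_sub, Prod.snd_sub, inner_sub_left]; ring

theorem lform_add_right {n : ℕ} (x y z : Lorentz n) :
    lform x (y + z) = lform x y + lform x z := by
  rw [lform_comm, lform_add_left, lform_comm y, lform_comm z]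

theorem lform_smul_right {n : ℕ} (a : ℝ) (x z : Lorentz n) :
    lform x (a • z) = a * lform x z := by
  rw [lform_comm, lform_smul_left, lform_comm]

theorem lform_sub_right {n : ℕ} (x y z : Lorentz n) :
    lform x (y - z) = lform x y - lform x z := by
  rw [lform_comm, lform_sub_left, lform_comm y, lform_comm z]

/-- Hyperbolic `n`-space: the upper sheet of the hyperboloid in `ℝ^{n,1}`. -/
@[ext]
structure HypSpace (n : ℕ) where
  vec : Lorentz n
  lform_self : lform vec vec = -1
  time_pos : 0 < vec.2

namespace HypSpace

variable {n : ℕ}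

theorem time_sq (x : HypSpace n) : x.vec.2 ^ 2 = 1 + ‖x.vec.1‖ ^ 2 := by
  have h := x.lform_self
  simp only [lform, real_inner_self_eq_norm_sq] at h
  nlinarith

/-- On the orthogonal complement of a point of hyperbolic space the form dominates. -/
theorem time_sq_mul_le (y : HypSpace n) (w : Lorentz n) (hw : lform w y.vec = 0) :
    w.2 ^ 2 * (1 + ‖y.vec.1‖ ^ 2) ≤ ‖w.1‖ ^ 2 * ‖y.vec.1‖ ^ 2 := by
  have h1 : inner ℝ w.1 y.vec.1 = w.2 * y.vec.2 := by
    simp only [lform] at hw; linarith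
  have h2 := abs_real_inner_le_norm w.1 y.vec.1
  rw [h1] at h2
  have h3 := pow_le_pow_left₀ (abs_nonneg _) h2 2
  rw [sq_abs, mul_pow, mul_pow, y.time_sq] at h3
  exact h3

theorem lform_self_nonneg (y : HypSpace n) (w : Lorentz n) (hw : lform w y.vec = 0) :
    0 ≤ lform w w := by
  have h := y.time_sq_mul_le w hw
  simp only [lform, real_inner_self_eq_norm_sq]
  by_contra hc
  push Not at hc
  nlinarith [sq_nonneg ‖y.vec.1‖, sq_nonneg ‖w.1‖]

theorem eq_zero_of_lform_self (y : HypSpace n) (w : Lorentz n) (hw : lform w y.vec = 0)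
    (h0 : lform w w = 0) : w = 0 := by
  have h := y.time_sq_mul_le w hw
  simp only [lform, real_inner_self_eq_norm_sq] at h0
  have h1 : w.2 ^ 2 ≤ 0 := by nlinarith
  have h2 : w.2 = 0 := by nlinarith [sq_nonneg w.2, pow_eq_zero_iff (two_ne_zero) (M₀ := ℝ) (a := w.2)]
  have h3 : ‖w.1‖ ^ 2 = 0 := by rw [h2] at h0; linarith
  have h4 : w.1 = 0 := by simpa using h3
  exact Prod.ext h4 h2

theorem lform_neg_of_time_pos (x y : HypSpace n) : lform x.vec y.vec ≤ -1 := by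
  have h2 := (abs_le.mp (abs_real_inner_le_norm x.vec.1 y.vec.1)).2
  have hs := x.time_sq
  have ht := y.time_sq
  have hx := x.time_pos
  have hy := y.time_pos
  have h3 : 1 + ‖x.vec.1‖ * ‖y.vec.1‖ ≤ x.vec.2 * y.vec.2 := by
    apply le_of_sq_le_sq _ (by positivity)
    rw [mul_pow, hs, ht]
    nlinarith [sq_nonneg (‖x.vec.1‖ - ‖y.vec.1‖)]
  simp only [lform]
  linarith

theorem one_le_neg_lform (x y : HypSpace n) : 1 ≤ -lform x.vec y.vec := by
  linarith [lform_neg_of_time_pos x y]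

theorem gram_le (x y z : HypSpace n) :
    (lform x.vec z.vec + lform x.vec y.vec * lform y.vec z.vec) ^ 2 ≤
      (lform x.vec y.vec ^ 2 - 1) * (lform y.vec z.vec ^ 2 - 1) := by
  set p := lform x.vec y.vec with hp
  set q := lform y.vec z.vec with hq
  set r := lform x.vec z.vec with hr
  have hzy : lform z.vec y.vec = q := lform_comm _ _
  have hyx : lform y.vec x.vec = p := lform_comm _ _
  have hzx : lform z.vec x.vec = r := lform_comm _ _
  have key : ∀ t : ℝ, 0 ≤ (p ^ 2 - 1) * (t * t) + (2 * (r + p * q)) * t + (q ^ 2 - 1) := by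
    intro t
    have h := y.lform_self_nonneg
      (t • (x.vec + p • y.vec) + (z.vec + q • y.vec)) (by
        simp only [lform_add_left, lform_smul_left, y.lform_self, hzy, ← hp]; ring)
    simp only [lform_add_left, lform_smul_left, lform_add_right, lform_smul_right,
      x.lform_self, y.lform_self, z.lform_self, hzy, hyx, hzx, ← hp, ← hq, ← hr] at h
    linarith
  have := discrim_le_zero key
  simp only [discrim] at this
  nlinarith

/-- The hyperbolic metric, `cosh d(x, y) = -⟨x, y⟩`. -/
instance : MetricSpace (HypSpace n) where
  dist x y := Real.arcosh (-lform x.vec y.vec)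
  dist_self x := by simp [x.lform_self]
  dist_comm x y := by rw [lform_comm]
  dist_triangle x y z := by
    have hp := one_le_neg_lform x y
    have hq := one_le_neg_lform y z
    have hr := one_le_neg_lform x z
    have h0 := add_nonneg (Real.arcosh_nonneg hp) (Real.arcosh_nonneg hq)
    rw [← Real.arcosh_cosh h0, Real.arcosh_le_arcosh (by linarith) (Real.cosh_pos _),
      Real.cosh_add, Real.cosh_arcosh hp, Real.cosh_arcosh hq, Real.sinh_arcosh hp,
      Real.sinh_arcosh hq, ← Real.sqrt_mul (by nlinarith)]
    have h1 := Real.abs_le_sqrt (gram_le x y z)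
    have h2 := (abs_le.mp h1).1
    simp only [neg_sq]
    nlinarith
  eq_of_dist_eq_zero := by
    intro x y h
    have h1 : -lform x.vec y.vec = 1 := (Real.arcosh_eq_zero_iff (one_le_neg_lform x y)).mp h
    have h2 : lform y.vec x.vec = lform x.vec y.vec := lform_comm _ _
    have h3 := y.eq_zero_of_lform_self (x.vec - y.vec)
      (by rw [lform_sub_left, y.lform_self]; linarith)
      (by rw [lform_sub_left, lform_sub_right, lform_sub_right, y.lform_self, x.lform_self]
          linarith)
    exact HypSpace.ext (sub_eq_zero.mp h3)

theorem dist_def (x y : HypSpace n) : dist x y = Real.arcosh (-lform x.vec y.vec) := rfl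

/-- The isometry group acts on hyperbolic space by evaluation. -/
instance : MulAction (HypSpace n ≃ᵢ HypSpace n) (HypSpace n) where
  smul g x := g x
  one_smul _ := rfl
  mul_smul _ _ _ := rfl

/-- The vertical projection of the hyperboloid to its space part is a global chart; this is
its inverse. -/
def lift (u : EuclideanSpace ℝ (Fin n)) : HypSpace n where
  vec := (u, √(1 + ‖u‖ ^ 2))
  lform_self := by
    simp only [lform, real_inner_self_eq_norm_sq]
    rw [Real.mul_self_sqrt (by positivity)]; ring
  time_pos := by simp only; positivity

theorem reflect_aux (e : Lorentz n) (he : lform e e = 1) (x y : Lorentz n) :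
    lform (x - (2 * lform x e) • e) (y - (2 * lform y e) • e) = lform x y := by
  simp only [lform_sub_left, lform_sub_right, lform_smul_left, lform_smul_right, he,
    lform_comm e y]
  ring

/-- The map underlying the reflection in the hyperplane `e^⊥`. -/
def reflectFun (e : Lorentz n) (he : lform e e = 1) (x : HypSpace n) : HypSpace n where
  vec := x.vec - (2 * lform x.vec e) • e
  lform_self := by rw [reflect_aux e he, x.lform_self]
  time_pos := by
    set y : Lorentz n := x.vec - (2 * lform x.vec e) • e with hy
    have hyy : lform y y = -1 := by rw [hy, reflect_aux e he, x.lform_self]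
    have hyx : lform y x.vec ≤ -1 := by
      rw [hy, lform_sub_left, lform_smul_left, x.lform_self, lform_comm e]
      nlinarith [sq_nonneg (lform x.vec e)]
    by_contra hc
    push Not at hc
    have h1 := (abs_le.mp (abs_real_inner_le_norm y.1 x.vec.1)).1
    have hs := x.time_sq
    have hx := x.time_pos
    simp only [lform, real_inner_self_eq_norm_sq] at hyy hyx
    have h2 : ‖y.1‖ * ‖x.vec.1‖ ≤ (-y.2) * x.vec.2 := by
      apply le_of_sq_le_sq _ (by nlinarith)
      rw [mul_pow, mul_pow, hs, neg_sq]
      nlinarith [sq_nonneg ‖y.1‖, sq_nonneg ‖x.vec.1‖]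
    nlinarith

/-- The reflection of hyperbolic space in the hyperplane `e^⊥`, for a unit normal vector `e`,
as an isometry. -/
def reflect (e : Lorentz n) (he : lform e e = 1) : HypSpace n ≃ᵢ HypSpace n :=
  have inv : ∀ x : HypSpace n, reflectFun e he (reflectFun e he x) = x := fun x => by
    apply HypSpace.ext
    simp only [reflectFun, lform_sub_left, lform_smul_left, he]
    module
  { toFun := reflectFun e he
    invFun := reflectFun e he
    left_inv := inv
    right_inv := inv
    isometry_toFun := Isometry.of_dist_eq fun x y => by
      simp only [dist_def, reflectFun, reflect_aux e he] }

end HypSpace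

/-- The dimension plus one of (the hyperbolic subspace spanned by) a subset of hyperbolic space:
a `k`-dimensional hyperbolic subspace spans a `(k+1)`-dimensional linear subspace. -/
def spanRank {n : ℕ} (S : Set (HypSpace n)) : ℕ :=
  Module.finrank ℝ (Submodule.span ℝ (HypSpace.vec '' S))

/-- A compact convex polytope of full dimension in hyperbolic space: a compact set with non-empty
interior which is an intersection of finitely many closed half-spaces. -/
structure IsCompactPolytope {n : ℕ} (P : Set (HypSpace n)) : Prop where
  isCompact : IsCompact P
  interior_nonempty : (interior P).Nonempty
  finite_halfSpaces : ∃ N : Finset (Lorentz n), (∀ e ∈ N, lform e e = 1) ∧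
    P = {x | ∀ e ∈ N, lform x.vec e ≤ 0}

/-- A facet (codimension-one face) of `P`. It is recorded through its outward unit normal, which
the facet determines when `P` has non-empty interior; the facet itself is `Facet.face`. -/
@[ext]
structure Facet {n : ℕ} (P : Set (HypSpace n)) where
  normal : Lorentz n
  lform_normal : lform normal normal = 1
  outward : ∀ x ∈ P, lform x.vec normal ≤ 0
  spanRank_face : spanRank {x ∈ P | lform x.vec normal = 0} = n

namespace Facet

variable {n : ℕ} {P : Set (HypSpace n)}

/-- The set of points of the facet. -/
def face (F : Facet P) : Set (HypSpace n) := {x ∈ P | lform x.vec F.normal = 0}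

/-- The reflection `r_F` in the hyperplane containing the facet. -/
def reflection (F : Facet P) : HypSpace n ≃ᵢ HypSpace n :=
  HypSpace.reflect F.normal F.lform_normal

/-- Two facets are adjacent if they are distinct and meet in a (non-empty) face of
codimension two. -/
def Adjacent (F G : Facet P) : Prop :=
  F ≠ G ∧ (F.face ∩ G.face).Nonempty ∧ spanRank (F.face ∩ G.face) + 1 = n

end Facet

/-- A compact right-angled polytope: all its dihedral angles are `π/2`, that is, adjacent facets
have orthogonal normals. -/
structure IsRightAngledPolytope {n : ℕ} (P : Set (HypSpace n)) : Prop
    extends IsCompactPolytope P where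
  right_angled : ∀ F G : Facet P, F.Adjacent G → lform F.normal G.normal = 0

/-- A vertex of `P`: a point `v` of `P` such that the facets through `v` have only `v`
in common (a zero-dimensional face). -/
def IsPolytopeVertex {n : ℕ} (P : Set (HypSpace n)) (v : HypSpace n) : Prop :=
  v ∈ P ∧ ∀ w ∈ P, (∀ F : Facet P, v ∈ F.face → w ∈ F.face) → w = v

/-- A `V`-colouring of `P`: at every vertex the colours of the facets through that vertex
are linearly independent. -/
def IsColouring {n : ℕ} (P : Set (HypSpace n)) {V : Type*} [AddCommGroup V] [Module (ZMod 2) V]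
    (col : Facet P → V) : Prop :=
  ∀ v : HypSpace n, IsPolytopeVertex P v →
    LinearIndependent (ZMod 2) (fun F : {F : Facet P // v ∈ F.face} => col F.1)

/-- The group generated by the reflections in the facets of `P`. -/
def reflectionGroup {n : ℕ} (P : Set (HypSpace n)) : Subgroup (HypSpace n ≃ᵢ HypSpace n) :=
  Subgroup.closure (Set.range (Facet.reflection (P := P)))

/-- The reflection in a facet as an element of the reflection group. -/
def Facet.gen {n : ℕ} {P : Set (HypSpace n)} (F : Facet P) : reflectionGroup P :=
  ⟨F.reflection, Subgroup.subset_closure ⟨F, rfl⟩⟩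

/-- The quotient map `ℍⁿ → ℍⁿ/G`, with `ℍⁿ` parametrised by its global chart. -/
def quotientParam {n : ℕ} (G : Type*) [Group G] [MulAction G (HypSpace n)]
    (u : EuclideanSpace ℝ (Fin n)) : MulAction.orbitRel.Quotient G (HypSpace n) :=
  Quotient.mk _ (HypSpace.lift u)

/-- The orbifold `ℍⁿ/G` is a manifold: `G` acts properly discontinuously on `ℍⁿ` and all isotropy
groups are trivial, the quotient map is a regular covering, and the quotient space is a Hausdorff
second countable smooth `n`-manifold such that the quotient map is a local diffeomorphism. -/
structure QuotientIsManifold (n : ℕ) (G : Type*) [Group G] [MulAction G (HypSpace n)] :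
    Prop where
  properlyDiscontinuous : ProperlyDiscontinuousSMul G (HypSpace n)
  free : ∀ (g : G) (x : HypSpace n), g • x = x → g = 1
  covering : IsQuotientCoveringMap
    (Quotient.mk _ : HypSpace n → MulAction.orbitRel.Quotient G (HypSpace n)) G
  t2 : T2Space (MulAction.orbitRel.Quotient G (HypSpace n))
  secondCountable : SecondCountableTopology (MulAction.orbitRel.Quotient G (HypSpace n))
  smooth : ∃ _ : ChartedSpace (EuclideanSpace ℝ (Fin n))
      (MulAction.orbitRel.Quotient G (HypSpace n)),
    IsManifold 𝓘(ℝ, EuclideanSpace ℝ (Fin n)) ∞ (MulAction.orbitRel.Quotient G (HypSpace n)) ∧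
    IsLocalDiffeomorph 𝓘(ℝ, EuclideanSpace ℝ (Fin n)) 𝓘(ℝ, EuclideanSpace ℝ (Fin n)) ∞
      (quotientParam (n := n) G)

end

/-! The proof works in the cone over `P` in Lorentz space and identifies `Γ` with an abstract
right-angled Coxeter group.

Geometry. Compactness puts the nonzero points of the cone over `P` in the open future light cone
(`timelike_of_mem_cone`), so linear arguments about irredundant half-spaces describe the facets. The
definition of right-angled only constrains facets that meet in codimension two;
`lform_eq_zero_or_le` upgrades this to all pairs: two distinct normals are orthogonal or have
product at most `-1`. Hence facets through a common point are orthogonal.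

Group theory. Let `s_F` be the generators of the Coxeter group in which `s_F` and `s_G` commute
exactly when the normals are orthogonal, with no relation otherwise. Tits' argument
(`facetGroup_halfSpace_aux`) shows that the length of `s_F u` against that of `u` decides on which
side of the hyperplane of `F` the tile `uP` lies. Faithfulness follows, so `Γ` has exactly the
Coxeter relations. They hold in every elementary abelian 2-group with arbitrary images, apart from
commutation which is automatic; this gives the homomorphism, and generation gives uniqueness. It
also follows that `P` is a strict fundamental domain and that the stabiliser of a point of `P` is
generated by the facets through it (`fundamental`).

Freeness. Such a stabiliser acts on the normals at the point by signs. Independence of the colours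
lets the image in `V` recover these signs, and trivial signs force the identity
(`eq_one_of_map_eq_one`). Every face has a vertex, so the colouring condition reaches all points,
and conjugation reaches all of hyperbolic space because the tiles cover it (`exists_smul_mem`). An
isometry of finite order has a fixed point, so the kernel is torsion-free. Local finiteness of the
tiling gives proper discontinuity, and the manifold structure follows. -/

namespace HypSpace

variable {n : ℕ}

/-! ### Topology of the hyperboloid model -/

theorem cosh_dist (x y : HypSpace n) : Real.cosh (dist x y) = -lform x.vec y.vec := by
  rw [dist_def, Real.cosh_arcosh (one_le_neg_lform x y)]

theorem continuous_lform : Continuous fun z : Lorentz n × Lorentz n => lform z.1 z.2 := by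
  unfold lform
  fun_prop

theorem continuous_lform_left (e : Lorentz n) : Continuous fun z : Lorentz n => lform z e :=
  continuous_lform.comp (by fun_prop : Continuous fun z : Lorentz n => (z, e))

theorem continuous_lform_self : Continuous fun z : Lorentz n => lform z z :=
  continuous_lform.comp (by fun_prop : Continuous fun z : Lorentz n => (z, z))

/-- The vector `y - cosh d(x, y) x` is orthogonal to `x`, where the form is positive definite and
controls the Euclidean norm. This makes the coordinates continuous for the hyperbolic metric. -/
theorem norm_sq_le (x y : HypSpace n) :
    ‖y.vec.1 - Real.cosh (dist x y) • x.vec.1‖ ^ 2 ≤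
      (1 + ‖x.vec.1‖ ^ 2) * (Real.cosh (dist x y) ^ 2 - 1) := by
  have hc := cosh_dist x y
  set c := Real.cosh (dist x y)
  have hyx : lform y.vec x.vec = -c := by rw [lform_comm, hc, neg_neg]
  have hxy : lform x.vec y.vec = -c := by rw [hc, neg_neg]
  have h1 : lform (y.vec - c • x.vec) x.vec = 0 := by
    rw [lform_sub_left, lform_smul_left, x.lform_self, hyx]; ring
  have h2 : lform (y.vec - c • x.vec) (y.vec - c • x.vec) = c ^ 2 - 1 := by
    rw [lform_sub_left, lform_smul_left, lform_sub_right, lform_sub_right, lform_smul_right,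
      lform_smul_right, x.lform_self, y.lform_self, hyx, hxy]; ring
  have h3 := x.time_sq_mul_le _ h1
  simp only [lform, real_inner_self_eq_norm_sq] at h2
  have h4 : (y.vec - c • x.vec).1 = y.vec.1 - c • x.vec.1 := rfl
  rw [h4] at h2 h3
  nlinarith [sq_nonneg ‖x.vec.1‖]

theorem continuous_vec_fst : Continuous fun x : HypSpace n => x.vec.1 := by
  rw [continuous_iff_continuousAt]
  intro x
  have hd : Filter.Tendsto (fun y : HypSpace n => Real.cosh (dist x y)) (nhds x) (nhds 1) := by
    have : Continuous fun y : HypSpace n => Real.cosh (dist x y) := by fun_prop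
    simpa using this.tendsto x
  have h1 : Filter.Tendsto (fun y : HypSpace n =>
      (1 + ‖x.vec.1‖ ^ 2) * (Real.cosh (dist x y) ^ 2 - 1)) (nhds x) (nhds 0) := by
    have := ((hd.pow 2).sub_const 1).const_mul (1 + ‖x.vec.1‖ ^ 2)
    simpa using this
  have h2 : Filter.Tendsto (fun y : HypSpace n =>
      ‖y.vec.1 - Real.cosh (dist x y) • x.vec.1‖ ^ 2) (nhds x) (nhds 0) :=
    squeeze_zero (fun _ => by positivity) (fun y => norm_sq_le x y) h1
  have h3 : Filter.Tendsto (fun y : HypSpace n =>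
      ‖y.vec.1 - Real.cosh (dist x y) • x.vec.1‖) (nhds x) (nhds 0) := by
    have := h2.sqrt
    simpa [Real.sqrt_sq] using this
  have h4 := tendsto_zero_iff_norm_tendsto_zero.mpr h3
  have h5 := h4.add (hd.smul_const x.vec.1)
  simpa [ContinuousAt] using h5

theorem vec_snd (x : HypSpace n) : x.vec.2 = √(1 + ‖x.vec.1‖ ^ 2) := by
  rw [← x.time_sq, Real.sqrt_sq x.time_pos.le]

theorem continuous_vec : Continuous (vec : HypSpace n → Lorentz n) := by
  refine continuous_vec_fst.prodMk ?_
  simp_rw [vec_snd]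
  have := continuous_vec_fst (n := n)
  fun_prop

theorem continuous_of_continuous_vec {X : Type*} [TopologicalSpace X] {f : X → HypSpace n}
    (hf : Continuous fun x => (f x).vec) : Continuous f := by
  rw [continuous_iff_continuousAt]
  intro x
  rw [ContinuousAt, tendsto_iff_dist_tendsto_zero]
  have h1 : Filter.Tendsto (fun y => -lform (f y).vec (f x).vec) (nhds x) (nhds 1) := by
    have h : Continuous fun y => -lform (f y).vec (f x).vec :=
      ((continuous_lform_left (f x).vec).comp hf).neg
    simpa [(f x).lform_self] using h.tendsto x
  -- The limit `1` is the endpoint of the interval on which `arcosh` is continuous, so the approach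
  -- must be confined to `[1, ∞)`.
  have h2 : Filter.Tendsto (fun y => -lform (f y).vec (f x).vec) (nhds x)
      (nhdsWithin 1 (Set.Ici 1)) :=
    tendsto_nhdsWithin_iff.mpr ⟨h1, Filter.Eventually.of_forall fun y =>
      one_le_neg_lform (f y) (f x)⟩
  have h3 := (Real.continuousOn_arcosh 1 (by simp)).tendsto.comp h2
  simpa [dist_def, Function.comp_def] using h3

theorem isInducing_vec : Topology.IsInducing (vec : HypSpace n → Lorentz n) := by
  refine ⟨le_antisymm continuous_vec.le_induced ?_⟩
  have : @Continuous _ _ (TopologicalSpace.induced vec inferInstance) _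
      (id : HypSpace n → HypSpace n) :=
    @continuous_of_continuous_vec n _ (TopologicalSpace.induced vec inferInstance) _
      continuous_induced_dom
  exact continuous_id_iff_le.mp this

/-- The vertical projection as a homeomorphism. -/
noncomputable def liftHomeomorph : EuclideanSpace ℝ (Fin n) ≃ₜ HypSpace n where
  toFun := lift
  invFun x := x.vec.1
  left_inv _ := rfl
  right_inv x := HypSpace.ext (Prod.ext rfl (vec_snd x).symm)
  continuous_toFun := continuous_of_continuous_vec (by simp only [lift]; fun_prop)
  continuous_invFun := continuous_vec_fst

instance : LocallyCompactSpace (HypSpace n) :=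
  liftHomeomorph.symm.isClosedEmbedding.locallyCompactSpace

instance : SecondCountableTopology (HypSpace n) :=
  liftHomeomorph.symm.secondCountableTopology

instance : ConnectedSpace (HypSpace n) :=
  liftHomeomorph.surjective.connectedSpace liftHomeomorph.continuous

/-! ### Cones over polytopes and irredundant half-spaces -/

/-- Radial projection of a future timelike vector to the hyperboloid. -/
noncomputable def normalize (z : Lorentz n) (h : lform z z < 0) (h0 : 0 < z.2) : HypSpace n where
  vec := (√(-lform z z))⁻¹ • z
  lform_self := by
    have : 0 < √(-lform z z) := Real.sqrt_pos.mpr (by linarith)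
    rw [lform_smul_left, lform_smul_right]
    have h2 : √(-lform z z) * √(-lform z z) = -lform z z := Real.mul_self_sqrt (by linarith)
    field_simp
    nlinarith
  time_pos := by
    have : 0 < √(-lform z z) := Real.sqrt_pos.mpr (by linarith)
    simp only [Prod.smul_snd, smul_eq_mul]
    positivity

theorem exists_smul_normalize (z : Lorentz n) (h : lform z z < 0) (h0 : 0 < z.2) :
    ∃ c : ℝ, 0 < c ∧ z = c • (normalize z h h0).vec := by
  have : 0 < √(-lform z z) := Real.sqrt_pos.mpr (by linarith)
  refine ⟨√(-lform z z), this, ?_⟩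
  simp only [normalize, smul_smul]
  rw [mul_inv_cancel₀ this.ne', one_smul]

theorem lform_isometry (g : HypSpace n ≃ᵢ HypSpace n) (x y : HypSpace n) :
    lform (g x).vec (g y).vec = lform x.vec y.vec := by
  have h := cosh_dist (g x) (g y)
  rw [g.isometry.dist_eq, cosh_dist] at h
  linarith

theorem reflect_vec (e : Lorentz n) (he : lform e e = 1) (x : HypSpace n) :
    (reflect e he x).vec = x.vec - (2 * lform x.vec e) • e := rfl

theorem lform_neg_left (x y : Lorentz n) : lform (-x) y = -lform x y := by
  rw [← neg_one_smul ℝ, lform_smul_left, neg_one_mul]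

theorem lform_zero_left (y : Lorentz n) : lform 0 y = 0 := by
  rw [← zero_smul ℝ (0 : Lorentz n), lform_smul_left, zero_mul]

/-- Interior points of a convex set lie strictly inside its half-spaces. -/
theorem lform_neg_of_mem_interior {P : Set (HypSpace n)} {p : HypSpace n} (hp : p ∈ interior P)
    {e : Lorentz n} (he : lform e e = 1) (hP : ∀ x ∈ P, lform x.vec e ≤ 0) :
    lform p.vec e < 0 := by
  refine lt_of_le_of_ne (hP p (interior_subset hp)) fun h0 => ?_
  obtain ⟨O, hO, hOP⟩ := isInducing_vec.isOpen_iff.mp (isOpen_interior (s := P))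
  have hpO : p.vec ∈ O := by rw [← hOP] at hp; exact hp
  have hq : ∀ s : ℝ, lform (p.vec + s • e) (p.vec + s • e) = -1 + s ^ 2 := fun s => by
    have h0' : lform e p.vec = 0 := by rw [lform_comm, h0]
    simp only [lform_add_left, lform_add_right, lform_smul_left, lform_smul_right, he,
      p.lform_self, h0, h0']
    ring
  -- If `p` lay on the hyperplane, pushing it slightly along `e` would stay in `P` yet pair
  -- positively with `e`.
  let g : ℝ → Lorentz n := fun s => (√(-(-1 + s ^ 2)))⁻¹ • (p.vec + s • e)
  have hg : ContinuousAt g 0 := by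
    have h1 : ContinuousAt (fun s : ℝ => √(-(-1 + s ^ 2))) 0 := by fun_prop
    have h2 : ContinuousAt (fun s : ℝ => p.vec + s • e) 0 := by fun_prop
    exact (h1.inv₀ (by simp)).smul h2
  have hg0 : g 0 = p.vec := by simp [g]
  have h1 : ∀ᶠ s in nhds (0 : ℝ), g s ∈ O := hg.eventually_mem (hg0 ▸ hO.mem_nhds hpO)
  have h2 : ∀ᶠ s in nhds (0 : ℝ), -1 + s ^ 2 < 0 := by
    have : Continuous fun s : ℝ => -1 + s ^ 2 := by fun_prop
    exact this.continuousAt.eventually_lt_const (by simp)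
  have h3 : ∀ᶠ s in nhds (0 : ℝ), 0 < (p.vec + s • e).2 := by
    have : Continuous fun s : ℝ => (p.vec + s • e).2 := by fun_prop
    exact this.continuousAt.eventually_const_lt (by simpa using p.time_pos)
  obtain ⟨s, ⟨h1, h2, h3⟩, hs⟩ := (((h1.and (h2.and h3)).filter_mono
    (nhdsWithin_le_nhds (s := Set.Ioi 0))).and self_mem_nhdsWithin).exists
  have hs' : lform (p.vec + s • e) (p.vec + s • e) < 0 := by rw [hq]; exact h2
  have hmem : normalize (p.vec + s • e) hs' h3 ∈ P := by
    apply interior_subset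
    rw [← hOP]
    simpa [normalize, g, hq] using h1
  have h4 := hP _ hmem
  obtain ⟨c, hc, hcz⟩ := exists_smul_normalize _ hs' h3
  have h5 : lform (p.vec + s • e) e = s := by
    rw [lform_add_left, lform_smul_left, he, h0]; ring
  rw [hcz, lform_smul_left] at h5
  have : (0 : ℝ) < s := hs
  nlinarith

/-- The cone over a compact intersection of half-spaces lies in the future light cone. -/
theorem timelike_of_mem_cone {P : Set (HypSpace n)} (hP : IsCompact P) {N : Set (Lorentz n)}
    (hN : N.Nonempty) (hPN : P = {x | ∀ e ∈ N, lform x.vec e ≤ 0}) {p : HypSpace n}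
    (hp : ∀ e ∈ N, lform p.vec e < 0) {z : Lorentz n} (hz : ∀ e ∈ N, lform z e ≤ 0)
    (hz0 : z ≠ 0) : lform z z < 0 ∧ 0 < z.2 := by
  obtain ⟨M, hM⟩ := hP.bddAbove_image
    (f := fun x : HypSpace n => x.vec.2) (continuous_snd.comp continuous_vec).continuousOn
  have hpP : p ∈ P := by rw [hPN]; exact fun e he => (hp e he).le
  have hM' : ∀ x ∈ P, x.vec.2 ≤ M := fun x hx => hM ⟨x, hx, rfl⟩
  have hM0 : 0 < M := p.time_pos.trans_le (hM' p hpP)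
  -- `O` is the open future cone and `D` a closed narrower cone given by the height bound `M` on
  -- `P`. On the segment from `p` to `z` the two coincide, so connectedness carries membership from
  -- `p` to `z`.
  let O : Set (Lorentz n) := {z | lform z z < 0 ∧ 0 < z.2}
  let D : Set (Lorentz n) := {z | z.2 ^ 2 + M ^ 2 * lform z z ≤ 0 ∧ 0 ≤ z.2}
  have hO : IsOpen O := (isOpen_lt continuous_lform_self continuous_const).inter
    (isOpen_lt continuous_const continuous_snd)
  have hD : IsClosed D := by
    have h1 : Continuous fun z : Lorentz n => z.2 ^ 2 + M ^ 2 * lform z z := by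
      have := continuous_lform_self (n := n)
      fun_prop
    exact (isClosed_le h1 continuous_const).inter (isClosed_le continuous_const continuous_snd)
  have hseg : ∀ y ∈ segment ℝ p.vec z, y ≠ 0 ∧ ∀ e ∈ N, lform y e ≤ 0 := by
    rintro y ⟨a, b, ha, hb, hab, rfl⟩
    constructor
    · rcases ha.eq_or_lt with rfl | ha
      · rw [zero_add] at hab; subst hab; simpa using hz0
      · intro h
        obtain ⟨e, he⟩ := hN
        have h1 : lform (a • p.vec + b • z) e = 0 := by rw [h, lform_zero_left]
        rw [lform_add_left, lform_smul_left, lform_smul_left] at h1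
        nlinarith [mul_neg_of_pos_of_neg ha (hp e he),
          mul_nonpos_of_nonneg_of_nonpos hb (hz e he)]
    · intro e he
      rw [lform_add_left, lform_smul_left, lform_smul_left]
      exact add_nonpos (mul_nonpos_of_nonneg_of_nonpos ha (hp e he).le)
        (mul_nonpos_of_nonneg_of_nonpos hb (hz e he))
  have hOD : ∀ y ∈ segment ℝ p.vec z, y ∈ O → y ∈ D := by
    intro y hy hyO
    obtain ⟨c, hc, hcy⟩ := exists_smul_normalize y hyO.1 hyO.2
    have hyP : normalize y hyO.1 hyO.2 ∈ P := by
      rw [hPN]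
      intro e he
      have := (hseg y hy).2 e he
      rw [hcy, lform_smul_left] at this
      exact nonpos_of_mul_nonpos_right this hc
    have h1 := hM' _ hyP
    set x := normalize y hyO.1 hyO.2
    refine ⟨?_, hyO.2.le⟩
    rw [hcy, lform_smul_left, lform_smul_right, x.lform_self]
    have : x.vec.2 ^ 2 ≤ M ^ 2 := pow_le_pow_left₀ x.time_pos.le h1 2
    simp only [Prod.smul_snd, smul_eq_mul]
    nlinarith [sq_nonneg c]
  have hDO : ∀ y ∈ segment ℝ p.vec z, y ∈ D → y ∈ O := by
    intro y hy ⟨h1, h2⟩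
    have h3 : y.2 ≠ 0 := by
      intro h3
      have h4 : lform y y = ‖y.1‖ ^ 2 := by
        simp [lform, h3]
      rw [h3, h4] at h1
      have h5 : y.1 = 0 := by
        by_contra hne
        have : 0 < ‖y.1‖ := norm_pos_iff.mpr hne
        have : 0 < M ^ 2 * ‖y.1‖ ^ 2 := by positivity
        linarith
      exact (hseg y hy).1 (Prod.ext h5 h3)
    have h4 : 0 < y.2 := lt_of_le_of_ne h2 h3.symm
    refine ⟨?_, h4⟩
    by_contra hc
    push Not at hc
    have : 0 ≤ M ^ 2 * lform y y := by positivity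
    have : 0 < y.2 ^ 2 := by positivity
    linarith
  have hsub : segment ℝ p.vec z ⊆ O := by
    intro y hy
    by_contra hyO
    obtain ⟨w, hw, hwO, hwD⟩ := (convex_segment p.vec z).isPreconnected O Dᶜ hO hD.isOpen_compl
      (fun w hw => (em (w ∈ O)).imp_right fun h hwD => h (hDO w hw hwD))
      ⟨p.vec, left_mem_segment ℝ _ _, by rw [p.lform_self]; norm_num, p.time_pos⟩
      ⟨y, hy, fun hyD => hyO (hDO y hy hyD)⟩
    exact hwD (hOD w hw hwO)
  exact hsub (right_mem_segment ℝ _ _)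

end HypSpace

/-- A defining subfamily of least cardinality works: omitting `i` admits a point violating only `i`
within the subfamily, and the segment from it to the interior point `p` crosses the wall `i`
strictly inside the other walls. -/
theorem exists_irredundant {E ι : Type*} [AddCommGroup E] [Module ℝ E] [DecidableEq ι]
    (f : ι → E →ₗ[ℝ] ℝ) (N : Finset ι) (p : E) (hp : ∀ i ∈ N, f i p < 0) :
    ∃ S ⊆ N, (∀ x, (∀ i ∈ S, f i x ≤ 0) → ∀ i ∈ N, f i x ≤ 0) ∧
      ∀ i ∈ S, ∃ z, f i z = 0 ∧ ∀ j ∈ S, j ≠ i → f j z < 0 := by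
  classical
  obtain ⟨S, hS, hmin⟩ := (N.powerset.filter fun S =>
    ∀ x, (∀ i ∈ S, f i x ≤ 0) → ∀ i ∈ N, f i x ≤ 0).exists_min_image Finset.card
      ⟨N, by simp⟩
  simp only [Finset.mem_filter, Finset.mem_powerset] at hS hmin
  refine ⟨S, hS.1, hS.2, fun i hi => ?_⟩
  have h1 : ¬ ∀ x, (∀ j ∈ S.erase i, f j x ≤ 0) → ∀ j ∈ N, f j x ≤ 0 := fun h =>
    (Finset.card_erase_lt_of_mem hi).not_ge
      (hmin _ ⟨(Finset.erase_subset _ _).trans hS.1, h⟩)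
  push Not at h1
  obtain ⟨y, hy, k, hk, hky⟩ := h1
  have hiy : 0 < f i y := by
    by_contra hc
    push Not at hc
    refine hky.not_ge (hS.2 y (fun j hj => ?_) k hk)
    rcases eq_or_ne j i with rfl | hji
    · exact hc
    · exact hy j (Finset.mem_erase.mpr ⟨hji, hj⟩)
  have hip := hp i (hS.1 hi)
  -- Both coefficients are positive, as `f i p < 0 < f i y`; they are chosen to make `f i` vanish.
  refine ⟨f i y • p - f i p • y, by simp [mul_comm], fun j hj hji => ?_⟩
  have h2 := hp j (hS.1 hj)
  have h3 := hy j (Finset.mem_erase.mpr ⟨hji, hj⟩)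
  simp only [map_sub, map_smul, smul_eq_mul]
  nlinarith [mul_neg_of_pos_of_neg hiy h2, mul_nonneg_of_nonpos_of_nonpos hip.le h3]

theorem exists_pos_add_smul_neg {E ι : Type*} [AddCommGroup E] [Module ℝ E]
    (f : ι → E →ₗ[ℝ] ℝ) {S : Set ι} (hS : S.Finite) (z v : E) (hz : ∀ i ∈ S, f i z < 0) :
    ∃ ε : ℝ, 0 < ε ∧ ∀ i ∈ S, f i (z + ε • v) < 0 := by
  have h : ∀ᶠ ε in nhdsWithin (0 : ℝ) (Set.Ioi 0), ∀ i ∈ S, f i (z + ε • v) < 0 := by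
    rw [Filter.eventually_all_finite hS]
    intro i hi
    refine Filter.Eventually.filter_mono nhdsWithin_le_nhds ?_
    have : Continuous fun ε : ℝ => f i z + ε * f i v := by fun_prop
    have h0 : f i z + 0 * f i v < 0 := by simpa using hz i hi
    simpa using (this.tendsto 0).eventually_lt_const h0
  obtain ⟨ε, h1, h2⟩ := (h.and self_mem_nhdsWithin).exists
  exact ⟨ε, h2, h1⟩

namespace HypSpace

variable {n : ℕ}

/-- The Lorentzian form as a functional of its first argument. -/
noncomputable def lformLin (e : Lorentz n) : Lorentz n →ₗ[ℝ] ℝ where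
  toFun z := lform z e
  map_add' x y := lform_add_left x y e
  map_smul' a x := lform_smul_left a x e

@[simp]
theorem lformLin_apply (e z : Lorentz n) : lformLin e z = lform z e := rfl

theorem eq_zero_of_forall_lform {w : Lorentz n} (h : ∀ x, lform x w = 0) : w = 0 := by
  have h1 := h (w.1, -w.2)
  simp only [lform, real_inner_self_eq_norm_sq] at h1
  have h2 : ‖w.1‖ ^ 2 = 0 := by nlinarith [sq_nonneg ‖w.1‖, sq_nonneg w.2]
  have h3 : w.2 ^ 2 = 0 := by nlinarith [sq_nonneg ‖w.1‖, sq_nonneg w.2]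
  exact Prod.ext (by simpa using h2) (by simpa using h3)

theorem finrank_lorentz : Module.finrank ℝ (Lorentz n) = n + 1 := by
  simp [Lorentz]

theorem finrank_ker_lformLin {e : Lorentz n} (he : lform e e = 1) :
    Module.finrank ℝ (LinearMap.ker (lformLin e)) = n := by
  have h : lformLin e ≠ 0 := fun h => by
    have := congrArg (fun f => f e) h
    simp [he] at this
  have := Module.Dual.finrank_ker_add_one_of_ne_zero h
  rw [finrank_lorentz] at this
  omega

theorem exists_lform_ne_zero {e e' : Lorentz n} (he : lform e e = 1) (he' : lform e' e' = 1)
    (h1 : e' ≠ e) (h2 : e' ≠ -e) : ∃ x, lform x e = 0 ∧ lform x e' ≠ 0 := by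
  by_contra hc
  push Not at hc
  set a := lform e e' with ha
  have h : e' - a • e = 0 := eq_zero_of_forall_lform fun x => by
    have := hc (x - lform x e • e) (by rw [lform_sub_left, lform_smul_left, he]; ring)
    rw [lform_sub_left, lform_smul_left, ← ha] at this
    rw [lform_sub_right, lform_smul_right]
    linarith
  have h3 : e' = a • e := sub_eq_zero.mp h
  rw [h3, lform_smul_left, lform_smul_right, he] at he'
  have h4 : (a - 1) * (a + 1) = 0 := by linarith
  rcases mul_eq_zero.mp h4 with h5 | h5
  · exact h1 (by rw [h3, sub_eq_zero.mp h5, one_smul])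
  · exact h2 (by rw [h3, eq_neg_of_add_eq_zero_left h5, neg_one_smul])

theorem finrank_ker_inf {e e' : Lorentz n} (he : lform e e = 1) (he' : lform e' e' = 1)
    (h1 : e' ≠ e) (h2 : e' ≠ -e) :
    Module.finrank ℝ ↥(LinearMap.ker (lformLin e) ⊓ LinearMap.ker (lformLin e')) + 1 = n := by
  obtain ⟨x, hx, hx'⟩ := exists_lform_ne_zero he he' h1 h2
  let g : Module.Dual ℝ (LinearMap.ker (lformLin e)) :=
    (lformLin e').domRestrict (LinearMap.ker (lformLin e))
  have hg : g ≠ 0 := fun h => hx' (congrArg (fun f => f ⟨x, hx⟩) h)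
  have h3 := Module.Dual.finrank_ker_add_one_of_ne_zero hg
  rw [finrank_ker_lformLin he] at h3
  have h4 : LinearMap.ker g = (LinearMap.ker (lformLin e')).comap
      (LinearMap.ker (lformLin e)).subtype := rfl
  rwa [h4, ← Submodule.finrank_map_subtype_eq, Submodule.map_comap_subtype] at h3

/-- A face of a polytope whose cone is a neighbourhood of a point in the subspace `U`
spans `U`. -/
theorem span_face_eq {P : Set (HypSpace n)} {N : Set (Lorentz n)}
    (hPN : P = {x | ∀ e ∈ N, lform x.vec e ≤ 0})
    (hN : ∀ z : Lorentz n, (∀ e ∈ N, lform z e ≤ 0) → z ≠ 0 → lform z z < 0 ∧ 0 < z.2)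
    {U : Submodule ℝ (Lorentz n)} {z : Lorentz n} (hz : z ∈ U)
    (hzU : ∀ v ∈ U, ∃ ε : ℝ, 0 < ε ∧ ∀ e ∈ N, lform (z + ε • v) e ≤ 0) :
    Submodule.span ℝ (vec '' {x ∈ P | x.vec ∈ U}) = U := by
  apply le_antisymm
  · rw [Submodule.span_le]
    rintro _ ⟨x, hx, rfl⟩
    exact hx.2
  have key : ∀ y ∈ U, (∀ e ∈ N, lform y e ≤ 0) →
      y ∈ Submodule.span ℝ (vec '' {x ∈ P | x.vec ∈ U}) := by
    intro y hyU hy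
    rcases eq_or_ne y 0 with rfl | hy0
    · exact Submodule.zero_mem _
    obtain ⟨h1, h2⟩ := hN y hy hy0
    obtain ⟨c, hc, hcy⟩ := exists_smul_normalize y h1 h2
    rw [hcy]
    refine Submodule.smul_mem _ _ (Submodule.subset_span ⟨_, ⟨?_, ?_⟩, rfl⟩)
    · rw [hPN]
      intro e he
      have := hy e he
      rw [hcy, lform_smul_left] at this
      exact nonpos_of_mul_nonpos_right this hc
    · exact U.smul_mem _ hyU
  have hzs := key z hz (by simpa using (hzU 0 U.zero_mem).choose_spec.2)
  intro v hv
  obtain ⟨ε, hε, h⟩ := hzU v hv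
  have h1 := key _ (U.add_mem hz (U.smul_mem ε hv)) h
  have h2 := Submodule.smul_mem _ ε⁻¹ (Submodule.sub_mem _ h1 hzs)
  rwa [add_sub_cancel_left, smul_smul, inv_mul_cancel₀ hε.ne', one_smul] at h2

end HypSpace

/-! ### Facets of a compact polytope -/

open HypSpace

variable {n : ℕ} {P : Set (HypSpace n)}

theorem Facet.span_face (F : Facet P) :
    Submodule.span ℝ (vec '' F.face) = LinearMap.ker (lformLin F.normal) := by
  refine Submodule.eq_of_le_of_finrank_eq ?_ ?_
  · rw [Submodule.span_le]
    rintro _ ⟨x, hx, rfl⟩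
    exact hx.2
  · rw [finrank_ker_lformLin F.lform_normal]
    exact F.spanRank_face

theorem Facet.lform_neg (F : Facet P) {p : HypSpace n} (hp : p ∈ interior P) :
    lform p.vec F.normal < 0 :=
  lform_neg_of_mem_interior hp F.lform_normal F.outward

theorem lform_neg_right (x y : Lorentz n) : lform x (-y) = -lform x y := by
  rw [lform_comm, lform_neg_left, lform_comm]

theorem Facet.normal_ne_neg (hP : (interior P).Nonempty) (F G : Facet P) :
    G.normal ≠ -F.normal := by
  obtain ⟨p, hp⟩ := hP
  intro h
  have h1 := F.lform_neg hp
  have h2 := G.lform_neg hp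
  rw [h, lform_neg_right] at h2
  linarith

/-- The facets of a polytope are finite in number, cut out the polytope, and each of them has a
relatively interior point. -/
theorem IsCompactPolytope.facets (hP : IsCompactPolytope P) :
    Finite (Facet P) ∧ P = {x | ∀ F : Facet P, lform x.vec F.normal ≤ 0} ∧
      ∀ F : Facet P, ∃ z, lform z F.normal = 0 ∧ ∀ G : Facet P, G ≠ F → lform z G.normal < 0 := by
  classical
  obtain ⟨N, hN, hPN⟩ := hP.finite_halfSpaces
  obtain ⟨p, hp⟩ := hP.interior_nonempty
  have hPN' : P = {x | ∀ e ∈ (N : Set (Lorentz n)), lform x.vec e ≤ 0} := hPN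
  have hmN : ∀ x, x ∈ P ↔ ∀ e ∈ N, lform x.vec e ≤ 0 := Set.ext_iff.mp hPN
  have hpN : ∀ e ∈ N, lform p.vec e < 0 := fun e he =>
    lform_neg_of_mem_interior hp (hN e he) fun x hx => (hmN x).mp hx e he
  obtain ⟨S, hSN, hS, hSz⟩ := exists_irredundant (fun e : Lorentz n => lformLin e) N p.vec hpN
  simp only [lformLin_apply] at hS hSz
  rcases N.eq_empty_or_nonempty with rfl | hNe
  · have hE : IsEmpty (Facet P) := ⟨fun F => by
      have h1 := F.outward (reflect F.normal F.lform_normal p) ((hmN _).mpr (by simp))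
      rw [reflect_vec, lform_sub_left, lform_smul_left, F.lform_normal] at h1
      linarith [F.lform_neg hp]⟩
    exact ⟨inferInstance, by ext x; simp [hmN], fun F => hE.elim F⟩
  have hT := fun z => timelike_of_mem_cone hP.isCompact (N := (N : Set (Lorentz n)))
    (by simpa using hNe) hPN' hpN (z := z)
  have hfin : ∀ e ∈ S, ∃ F : Facet P, F.normal = e := by
    intro e he
    obtain ⟨z, hz, hz'⟩ := hSz e he
    have heN := hN e (hSN he)
    refine ⟨⟨e, heN, fun x hx => (hmN x).mp hx e (hSN he), ?_⟩, rfl⟩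
    have := span_face_eq hPN' hT (U := LinearMap.ker (lformLin e)) (z := z) hz fun v hv => by
      obtain ⟨ε, hε, h⟩ := exists_pos_add_smul_neg (fun e : Lorentz n => lformLin e)
        (S := {j | j ∈ S ∧ j ≠ e}) (S.finite_toSet.subset fun j hj => hj.1) z v
        fun j hj => hz' j hj.1 hj.2
      refine ⟨ε, hε, fun j hj => hS _ (fun j hj => ?_) j hj⟩
      rcases eq_or_ne j e with rfl | hje
      · have hv' : lform v j = 0 := hv
        rw [lform_add_left, lform_smul_left, hz, hv', mul_zero, add_zero]
      · exact (h j ⟨hj, hje⟩).le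
    have h2 : spanRank {x ∈ P | lform x.vec e = 0} =
        Module.finrank ℝ (LinearMap.ker (lformLin e)) := by rw [← this]; rfl
    rw [h2, finrank_ker_lformLin heN]
  have hmem : ∀ F : Facet P, F.normal ∈ S := by
    intro F
    -- Otherwise each wall in `S` is avoided by some point of the facet. The sum of these points is
    -- strictly inside all walls yet on the hyperplane of `F`, so it can be pushed across that
    -- hyperplane without leaving the cone.
    have h1 : ∃ e ∈ S, ∀ x ∈ F.face, lform x.vec e = 0 := by
      by_contra hc
      push Not at hc
      choose! y hyF hy using hc
      have hy' : ∀ e ∈ S, ∀ e' ∈ S, lform (y e).vec e' ≤ 0 := fun e he e' he' => by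
        exact (hmN _).mp (hyF e he).1 e' (hSN he')
      let z := ∑ e ∈ S, (y e).vec
      have hz : ∀ e ∈ S, lformLin e z < 0 := fun e he => by
        rw [map_sum]
        exact Finset.sum_neg' (fun e' he' => hy' e' he' e he)
          ⟨e, he, lt_of_le_of_ne (hy' e he e he) (hy e he)⟩
      have hzF : lformLin F.normal z = 0 := by
        rw [map_sum]
        exact Finset.sum_eq_zero fun e he => (hyF e he).2
      obtain ⟨ε, hε, h⟩ := exists_pos_add_smul_neg (fun e : Lorentz n => lformLin e)
        S.finite_toSet z F.normal hz
      have h2 : lformLin F.normal (z + ε • F.normal) = ε := by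
        rw [map_add, hzF, map_smul, lformLin_apply, F.lform_normal]; simp
      have h3 : ∀ e ∈ N, lform (z + ε • F.normal) e ≤ 0 := hS _ fun e he => (h e he).le
      have h4 : z + ε • F.normal ≠ 0 := fun h0 => by
        rw [h0, map_zero] at h2; exact hε.ne h2
      obtain ⟨h5, h6⟩ := hT _ h3 h4
      obtain ⟨c, hc, hcy⟩ := exists_smul_normalize _ h5 h6
      have h7 := F.outward (normalize _ h5 h6) (by
        rw [hmN]
        intro e he
        have := h3 e he
        rw [hcy, lform_smul_left] at this
        exact nonpos_of_mul_nonpos_right this hc)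
      rw [lformLin_apply, hcy, lform_smul_left] at h2
      nlinarith
    obtain ⟨e, he, h⟩ := h1
    have h2 : LinearMap.ker (lformLin F.normal) ≤ LinearMap.ker (lformLin e) := by
      rw [← F.span_face, Submodule.span_le]
      rintro _ ⟨x, hx, rfl⟩
      exact h x hx
    by_cases h3 : e = F.normal
    · exact h3 ▸ he
    · exfalso
      obtain ⟨G, hG⟩ := hfin e he
      obtain ⟨x, hx, hx'⟩ := exists_lform_ne_zero F.lform_normal (hN e (hSN he)) h3
        (hG ▸ F.normal_ne_neg hP.interior_nonempty G)
      exact hx' (h2 hx)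
  refine ⟨?_, ?_, fun F => ?_⟩
  · exact Finite.of_injective (fun F : Facet P => (⟨F.normal, hmem F⟩ : S)) fun F G h =>
      Facet.ext (congrArg Subtype.val h)
  · ext x
    refine ⟨fun hx F => F.outward x hx, fun hx => ?_⟩
    rw [hmN]
    refine hS _ fun e he => ?_
    obtain ⟨F, rfl⟩ := hfin e he
    exact hx F
  · obtain ⟨z, hz, hz'⟩ := hSz _ (hmem F)
    exact ⟨z, hz, fun G hG => hz' _ (hmem G) fun h => hG (Facet.ext h)⟩

theorem IsCompactPolytope.finite_facet (hP : IsCompactPolytope P) : Finite (Facet P) :=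
  hP.facets.1

theorem IsCompactPolytope.mem_iff (hP : IsCompactPolytope P) {x : HypSpace n} :
    x ∈ P ↔ ∀ F : Facet P, lform x.vec F.normal ≤ 0 :=
  Set.ext_iff.mp hP.facets.2.1 x

theorem IsCompactPolytope.timelike (hP : IsCompactPolytope P) (F : Facet P) {z : Lorentz n}
    (hz : ∀ G : Facet P, lform z G.normal ≤ 0) (hz0 : z ≠ 0) : lform z z < 0 ∧ 0 < z.2 := by
  obtain ⟨p, hp⟩ := hP.interior_nonempty
  refine timelike_of_mem_cone hP.isCompact (N := Set.range (Facet.normal (P := P)))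
    ⟨_, F, rfl⟩ ?_ (p := p) ?_ ?_ hz0
  · ext x; simp [hP.mem_iff]
  · rintro _ ⟨G, rfl⟩; exact G.lform_neg hp
  · rintro _ ⟨G, rfl⟩; exact hz G

/-- Non-zero points of the cone over a polytope are positive multiples of points of it. -/
theorem IsCompactPolytope.exists_smul (hP : IsCompactPolytope P) (F : Facet P) {z : Lorentz n}
    (hz : ∀ G : Facet P, lform z G.normal ≤ 0) (hz0 : z ≠ 0) :
    ∃ x ∈ P, ∃ c : ℝ, 0 < c ∧ z = c • x.vec := by
  obtain ⟨h1, h2⟩ := hP.timelike F hz hz0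
  obtain ⟨c, hc, hcz⟩ := exists_smul_normalize z h1 h2
  refine ⟨normalize z h1 h2, ?_, c, hc, hcz⟩
  rw [hP.mem_iff]
  intro G
  have := hz G
  rw [hcz, lform_smul_left] at this
  exact nonpos_of_mul_nonpos_right this hc

/-! ### Adjacency and the Gram matrix of the normals -/

/-- Two facets whose intersection has a point in relative position are adjacent. -/
theorem IsCompactPolytope.adjacent_of_nhds (hP : IsCompactPolytope P) {F G : Facet P}
    (hFG : F ≠ G) {z : Lorentz n} (hz0 : z ≠ 0) (hzF : lform z F.normal = 0)
    (hzG : lform z G.normal = 0)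
    (h : ∀ v, lform v F.normal = 0 → lform v G.normal = 0 →
      ∃ ε : ℝ, 0 < ε ∧ ∀ H : Facet P, lform (z + ε • v) H.normal ≤ 0) : F.Adjacent G := by
  have hset : F.face ∩ G.face = {x ∈ P | x.vec ∈
      LinearMap.ker (lformLin F.normal) ⊓ LinearMap.ker (lformLin G.normal)} := by
    ext x
    simp only [Facet.face, Set.mem_inter_iff, Set.mem_ofPred_eq, Submodule.mem_inf,
      LinearMap.mem_ker, lformLin_apply]
    tauto
  refine ⟨hFG, ?_, ?_⟩
  · obtain ⟨ε, hε, hz⟩ := h 0 (lform_zero_left _) (lform_zero_left _)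
    rw [smul_zero, add_zero] at hz
    obtain ⟨x, hx, c, hc, hcx⟩ := hP.exists_smul F hz hz0
    rw [hcx, lform_smul_left] at hzF hzG
    exact ⟨x, ⟨hx, (mul_eq_zero.mp hzF).resolve_left hc.ne'⟩,
      ⟨hx, (mul_eq_zero.mp hzG).resolve_left hc.ne'⟩⟩
  · have := span_face_eq (P := P) (N := Set.range (Facet.normal (P := P)))
      (by ext x; simp [hP.mem_iff])
      (fun z hz hz0 => hP.timelike F (fun G => hz _ ⟨G, rfl⟩) hz0)
      (U := LinearMap.ker (lformLin F.normal) ⊓ LinearMap.ker (lformLin G.normal)) (z := z)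
      ⟨hzF, hzG⟩ fun v hv => by simpa using h v hv.1 hv.2
    rw [spanRank, hset, this]
    exact finrank_ker_inf F.lform_normal G.lform_normal (fun h => hFG (Facet.ext h.symm))
      (F.normal_ne_neg hP.interior_nonempty G)

/-- In dimension at least two, a facet of a right-angled polytope is cut out of its hyperplane by
the adjacent facets. -/
theorem IsRightAngledPolytope.mem_cone_of_adjacent (hP : IsRightAngledPolytope P) (hn : 2 ≤ n)
    (F : Facet P) {x : Lorentz n} (hxF : lform x F.normal = 0)
    (hx : ∀ G : Facet P, F.Adjacent G → lform x G.normal ≤ 0) (G : Facet P) :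
    lform x G.normal ≤ 0 := by
  classical
  have := hP.finite_facet
  have := Fintype.ofFinite (Facet P)
  have hC := hP.toIsCompactPolytope
  obtain ⟨p, hpF, hp⟩ := hC.facets.2.2 F
  -- `f G` pairs with the normal of `G` after orthogonal projection to the hyperplane of `F`;
  -- irredundancy is thus applied inside that hyperplane.
  let f : Facet P → Lorentz n →ₗ[ℝ] ℝ := fun G =>
    lformLin G.normal - lform F.normal G.normal • lformLin F.normal
  have hf : ∀ G y, f G y = lform y G.normal - lform F.normal G.normal * lform y F.normal :=
    fun G y => rfl
  have hf0 : ∀ G y, lform y F.normal = 0 → f G y = lform y G.normal := fun G y hy => by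
    rw [hf, hy, mul_zero, sub_zero]
  obtain ⟨S, hSN, hS, hSz⟩ := exists_irredundant f (Finset.univ.erase F) p
    (fun G hG => by rw [hf0 G p hpF]; exact hp G (Finset.ne_of_mem_erase hG))
  have hcone : ∀ y, lform y F.normal = 0 → (∀ H ∈ S, f H y ≤ 0) → ∀ H : Facet P,
      lform y H.normal ≤ 0 := by
    intro y hy h H
    rcases eq_or_ne H F with rfl | hHF
    · exact hy.le
    · rw [← hf0 H y hy]
      exact hS y h H (Finset.mem_erase.mpr ⟨hHF, Finset.mem_univ _⟩)
  refine hcone x hxF (fun H hH => ?_) G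
  rw [hf0 H x hxF]
  refine hx H ?_
  obtain ⟨z, hz, hz'⟩ := hSz H hH
  have hHF : H ≠ F := Finset.ne_of_mem_erase (hSN hH)
  set z' := z - lform z F.normal • F.normal with hzdef
  have hz'F : lform z' F.normal = 0 := by
    rw [hzdef, lform_sub_left, lform_smul_left, F.lform_normal]; ring
  have hfz : ∀ K, f K z' = f K z := fun K => by
    rw [hf0 K z' hz'F, hzdef, lform_sub_left, lform_smul_left, hf]; ring
  have hz'H : lform z' H.normal = 0 := by rw [← hf0 H z' hz'F, hfz, hz]
  have hnhds : ∀ v, lform v F.normal = 0 → lform v H.normal = 0 →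
      ∃ ε : ℝ, 0 < ε ∧ ∀ K : Facet P, lform (z' + ε • v) K.normal ≤ 0 := by
    intro v hvF hvH
    obtain ⟨ε, hε, h⟩ := exists_pos_add_smul_neg f (S := {K | K ∈ S ∧ K ≠ H})
      (Set.toFinite _) z' v fun K hK => by rw [hfz]; exact hz' K hK.1 hK.2
    refine ⟨ε, hε, hcone _ ?_ fun K hK => ?_⟩
    · rw [lform_add_left, lform_smul_left, hz'F, hvF, mul_zero, add_zero]
    · rcases eq_or_ne K H with rfl | hKH
      · rw [map_add, map_smul, hf0 K z' hz'F, hf0 K v hvF, hz'H, hvH]; simp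
      · exact (h K ⟨hK, hKH⟩).le
  refine hC.adjacent_of_nhds hHF.symm ?_ hz'F hz'H hnhds
  -- If `z'` were zero, the whole codimension-two subspace would lie in the cone. It is nonzero
  -- because `2 ≤ n`, so it contains some `v ≠ 0` and `-v`, which cannot both point to the future.
  intro h0
  have hfr := finrank_ker_inf F.lform_normal H.lform_normal (fun h => hHF (Facet.ext h))
    (F.normal_ne_neg hP.interior_nonempty H)
  have hpos : 0 < Module.finrank ℝ
      ↥(LinearMap.ker (lformLin F.normal) ⊓ LinearMap.ker (lformLin H.normal)) := by omega
  have := Module.nontrivial_of_finrank_pos hpos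
  obtain ⟨⟨v, hvF, hvH⟩, hv0⟩ := exists_ne
    (0 : ↥(LinearMap.ker (lformLin F.normal) ⊓ LinearMap.ker (lformLin H.normal)))
  have hv0' : v ≠ 0 := fun h => hv0 (Subtype.ext h)
  have key : ∀ w, w ≠ 0 → lform w F.normal = 0 → lform w H.normal = 0 → 0 < w.2 := by
    intro w hw hwF hwH
    obtain ⟨ε, hε, h⟩ := hnhds w hwF hwH
    rw [h0, zero_add] at h
    have := (hC.timelike F h (smul_ne_zero hε.ne' hw)).2
    rw [Prod.smul_snd, smul_eq_mul] at this
    exact (mul_pos_iff_of_pos_left hε).mp this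
  have h1 := key v hv0' hvF hvH
  have h2 := key (-v) (neg_ne_zero.mpr hv0') (by rw [lform_neg_left, show lform v _ = 0 from hvF,
    neg_zero]) (by rw [lform_neg_left, show lform v _ = 0 from hvH, neg_zero])
  rw [Prod.snd_neg] at h2
  linarith

/-- Project a relatively interior point `z` of `G` to the hyperplane of `F`. Pairings with facets
adjacent to `F` are unchanged by orthogonality, so the projection lies in the cone over the facet
`F`. Its pairing with the normal of `G` is a positive multiple of the product sought, and equality
is excluded by a perturbation. -/
theorem IsRightAngledPolytope.lform_neg_of_not_adjacent (hP : IsRightAngledPolytope P)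
    {F G : Facet P} (hFG : F ≠ G) (hadj : ¬ F.Adjacent G) :
    lform F.normal G.normal < 0 := by
  have := hP.finite_facet
  have hC := hP.toIsCompactPolytope
  have hGF : G.normal ≠ F.normal := fun h => hFG (Facet.ext h.symm)
  have hGF' := F.normal_ne_neg hP.interior_nonempty G
  have hfr := finrank_ker_inf F.lform_normal G.lform_normal hGF hGF'
  obtain ⟨z, hzG, hz⟩ := hC.facets.2.2 G
  have hzF := hz F hFG
  set z' := z - lform z F.normal • F.normal with hzdef
  have hz'F : lform z' F.normal = 0 := by
    rw [hzdef, lform_sub_left, lform_smul_left, F.lform_normal]; ring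
  have hz'G : lform z' G.normal = -lform z F.normal * lform F.normal G.normal := by
    rw [hzdef, lform_sub_left, lform_smul_left, hzG]; ring
  by_cases hn : 2 ≤ n
  · have hz'H : ∀ H : Facet P, F.Adjacent H → lform z' H.normal < 0 := by
      intro H hH
      rw [hzdef, lform_sub_left, lform_smul_left, hP.right_angled F H hH, mul_zero, sub_zero]
      exact hz H fun h => hadj (h ▸ hH)
    have h1 := hP.mem_cone_of_adjacent hn F hz'F (fun H hH => (hz'H H hH).le) G
    rw [hz'G] at h1
    refine lt_of_le_of_ne (by nlinarith) fun h0 => ?_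
    rw [h0, mul_zero] at hz'G
    obtain ⟨x, hxF, hxG⟩ := exists_lform_ne_zero F.lform_normal G.lform_normal hGF hGF'
    obtain ⟨y, hyF, hyG⟩ : ∃ y, lform y F.normal = 0 ∧ 0 < lform y G.normal := by
      rcases hxG.lt_or_gt with h | h
      · exact ⟨-x, by rw [lform_neg_left, hxF, neg_zero], by rw [lform_neg_left]; linarith⟩
      · exact ⟨x, hxF, h⟩
    obtain ⟨ε, hε, h⟩ := exists_pos_add_smul_neg (fun H : Facet P => lformLin H.normal)
      (S := {H | F.Adjacent H}) (Set.toFinite _) z' y hz'H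
    have h2 := hP.mem_cone_of_adjacent hn F (x := z' + ε • y)
      (by rw [lform_add_left, lform_smul_left, hz'F, hyF, mul_zero, add_zero])
      (fun H hH => (h H hH).le) G
    rw [lform_add_left, lform_smul_left, hz'G] at h2
    nlinarith
  -- Here the hyperplane of `F` meets hyperbolic space in a single point `x`, so the projection of
  -- `z` is a multiple of `x`.
  · have hn1 : n = 1 := by omega
    have hfr1 : Module.finrank ℝ (LinearMap.ker (lformLin F.normal)) = 1 := by
      rw [finrank_ker_lformLin F.lform_normal, hn1]
    obtain ⟨x, hx⟩ : F.face.Nonempty := by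
      by_contra hc
      rw [Set.not_nonempty_iff_eq_empty] at hc
      have := F.span_face
      rw [hc, Set.image_empty, Submodule.span_empty] at this
      rw [← this, finrank_bot] at hfr1
      omega
    have hx0 : x.vec ≠ 0 := fun h => by
      have := x.time_pos
      rw [h] at this
      exact lt_irrefl _ this
    obtain ⟨c, hc⟩ := (finrank_eq_one_iff_of_nonzero'
      (⟨x.vec, hx.2⟩ : LinearMap.ker (lformLin F.normal))
      (fun h => hx0 (congrArg Subtype.val h))).mp hfr1 ⟨z', hz'F⟩
    have hc : c • x.vec = z' := congrArg Subtype.val hc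
    have hz0 : z ≠ 0 := fun h => by rw [h, lform_zero_left] at hzF; exact lt_irrefl _ hzF
    obtain ⟨y, -, d, hd, hzy⟩ := hC.exists_smul F (z := z) (fun H => by
      rcases eq_or_ne H G with rfl | h
      · exact hzG.le
      · exact (hz H h).le) hz0
    have hFx : lform F.normal x.vec = 0 := by rw [lform_comm]; exact hx.2
    have h1 : -c = d * lform y.vec x.vec := by
      have : lform z' x.vec = lform z x.vec := by
        rw [hzdef, lform_sub_left, lform_smul_left, hFx]; ring
      rw [← hc, hzy, lform_smul_left, lform_smul_left, x.lform_self] at this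
      linarith
    have hcpos : 0 < c := by nlinarith [one_le_neg_lform y x]
    have hxG : lform x.vec G.normal < 0 := by
      refine lt_of_le_of_ne (G.outward x hx.1) fun h => hx0 ?_
      have h0 : LinearMap.ker (lformLin F.normal) ⊓ LinearMap.ker (lformLin G.normal) = ⊥ :=
        Submodule.finrank_eq_zero.mp (by omega)
      have : x.vec ∈ LinearMap.ker (lformLin F.normal) ⊓ LinearMap.ker (lformLin G.normal) :=
        ⟨hx.2, h⟩
      rwa [h0, Submodule.mem_bot] at this
    rw [← hc, lform_smul_left] at hz'G
    by_contra hge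
    push Not at hge
    nlinarith [mul_neg_of_pos_of_neg hcpos hxG, mul_nonneg (neg_pos.mpr hzF).le hge]

theorem IsRightAngledPolytope.lform_nonpos (hP : IsRightAngledPolytope P) {F G : Facet P}
    (hFG : F ≠ G) : lform F.normal G.normal ≤ 0 := by
  by_cases h : F.Adjacent G
  · exact (hP.right_angled F G h).le
  · exact (hP.lform_neg_of_not_adjacent hFG h).le

/-- The normals of distinct facets of a right-angled polytope are orthogonal, or their
hyperplanes do not meet. -/
theorem IsRightAngledPolytope.lform_eq_zero_or_le (hP : IsRightAngledPolytope P) {F G : Facet P}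
    (hFG : F ≠ G) : lform F.normal G.normal = 0 ∨ lform F.normal G.normal ≤ -1 := by
  by_cases hadj : F.Adjacent G
  · exact .inl (hP.right_angled F G hadj)
  right
  by_contra hlt
  push Not at hlt
  have := hP.finite_facet
  have ha0 := hP.lform_neg_of_not_adjacent hFG hadj
  have hC := hP.toIsCompactPolytope
  obtain ⟨p, hp⟩ := hP.interior_nonempty
  have hGF : lform G.normal F.normal = lform F.normal G.normal := lform_comm _ _
  set a := lform F.normal G.normal with ha
  have hu := F.lform_neg hp
  have hv := G.lform_neg hp
  set u := lform p.vec F.normal with hudef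
  set v := lform p.vec G.normal with hvdef
  have hden : 0 < 1 - a ^ 2 := by nlinarith
  -- For `-1 < a < 0`, project the interior point `p` to the intersection of both hyperplanes. The
  -- coefficients come from Cramer's rule and are nonnegative because `a`, `u`, `v` are negative. As
  -- products of distinct normals are nonpositive, the projection stays strictly inside all other
  -- walls, making `F` and `G` adjacent.
  obtain ⟨α, β, hα, hβ, h1, h2⟩ : ∃ α β : ℝ, 0 ≤ α ∧ 0 ≤ β ∧ u + α + β * a = 0 ∧
      v + α * a + β = 0 := by
    refine ⟨(a * v - u) / (1 - a ^ 2), (a * u - v) / (1 - a ^ 2), ?_, ?_, ?_, ?_⟩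
    · exact div_nonneg (by nlinarith) hden.le
    · exact div_nonneg (by nlinarith) hden.le
    · field_simp; ring
    · field_simp; ring
  set q := p.vec + α • F.normal + β • G.normal with hq
  have hqH : ∀ H : Facet P, lform q H.normal = lform p.vec H.normal +
      α * lform F.normal H.normal + β * lform G.normal H.normal := fun H => by
    rw [hq, lform_add_left, lform_add_left, lform_smul_left, lform_smul_left]
  have hqF : lform q F.normal = 0 := by
    rw [hqH, F.lform_normal, hGF, ← hudef, mul_one]; exact h1
  have hqG : lform q G.normal = 0 := by
    rw [hqH, G.lform_normal, ← hvdef, ← ha, mul_one]; exact h2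
  refine hadj (hC.adjacent_of_nhds hFG (z := q) ?_ hqF hqG fun w hwF hwG => ?_)
  · intro h0
    have h3 : lform q p.vec = 0 := by rw [h0, lform_zero_left]
    rw [hq, lform_add_left, lform_add_left, lform_smul_left, lform_smul_left, p.lform_self,
      lform_comm F.normal, lform_comm G.normal, ← hudef, ← hvdef] at h3
    nlinarith
  · obtain ⟨ε, hε, h⟩ := exists_pos_add_smul_neg (fun H : Facet P => lformLin H.normal)
      (S := {H | H ≠ F ∧ H ≠ G}) (Set.toFinite _) q w fun H hH => by
        rw [lformLin_apply, hqH]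
        have := H.lform_neg hp
        have h3 := hP.lform_nonpos hH.1.symm
        have h4 := hP.lform_nonpos hH.2.symm
        nlinarith [mul_nonneg hα (neg_nonneg.mpr h3), mul_nonneg hβ (neg_nonneg.mpr h4)]
    refine ⟨ε, hε, fun H => ?_⟩
    by_cases hHF : H = F
    · rw [hHF, lform_add_left, lform_smul_left, hqF, hwF, mul_zero, add_zero]
    by_cases hHG : H = G
    · rw [hHG, lform_add_left, lform_smul_left, hqG, hwG, mul_zero, add_zero]
    exact (h H ⟨hHF, hHG⟩).le

/-- Facets of a right-angled polytope through a common point are orthogonal. -/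
theorem IsRightAngledPolytope.lform_eq_zero_of_mem (hP : IsRightAngledPolytope P) {F G : Facet P}
    (hFG : F ≠ G) {x : HypSpace n} (hF : x ∈ F.face) (hG : x ∈ G.face) :
    lform F.normal G.normal = 0 := by
  -- With product at most `-1`, the sum of the normals would have nonpositive square while
  -- orthogonal to `x`, hence vanish.
  refine (hP.lform_eq_zero_or_le hFG).resolve_right fun h => ?_
  have hGF : lform G.normal F.normal = lform F.normal G.normal := lform_comm _ _
  have hx : lform (F.normal + G.normal) x.vec = 0 := by
    rw [lform_add_left, lform_comm, hF.2, lform_comm, hG.2, add_zero]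
  have hself : lform (F.normal + G.normal) (F.normal + G.normal) =
      2 + 2 * lform F.normal G.normal := by
    rw [lform_add_left, lform_add_right, lform_add_right, F.lform_normal, G.lform_normal, hGF]
    ring
  have h0 := x.lform_self_nonneg _ hx
  have h1 := x.eq_zero_of_lform_self _ hx (by linarith)
  exact F.normal_ne_neg hP.interior_nonempty G (eq_neg_of_add_eq_zero_right h1)

/-! ### Existence of vertices -/

theorem HypSpace.subsingleton_of_isCompact_univ (h : IsCompact (Set.univ : Set (HypSpace n))) :
    Subsingleton (HypSpace n) := by
  have := isCompact_univ_iff.mp h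
  have h1 : CompactSpace (EuclideanSpace ℝ (Fin n)) := liftHomeomorph.symm.compactSpace
  have h2 : Subsingleton (EuclideanSpace ℝ (Fin n)) := by
    by_contra hn
    rw [not_subsingleton_iff_nontrivial] at hn
    have := NormedSpace.noncompactSpace ℝ (EuclideanSpace ℝ (Fin n))
    exact not_compactSpace_iff.mpr this h1
  exact liftHomeomorph.symm.injective.subsingleton

/-- Every point of a polytope lies on a face with a vertex. -/
theorem IsCompactPolytope.exists_vertex (hP : IsCompactPolytope P) {y : HypSpace n}
    (hy : y ∈ P) : ∃ v, IsPolytopeVertex P v ∧ ∀ F : Facet P, y ∈ F.face → v ∈ F.face := by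
  have := hP.finite_facet
  let A : HypSpace n → Set (Facet P) := fun v => {F | v ∈ F.face}
  -- A point lying on a maximal set of facets, among those containing the facets through `y`, is a
  -- vertex.
  obtain ⟨B, hB⟩ := (Set.toFinite {B | ∃ v ∈ P, A y ⊆ A v ∧ B = A v}).exists_maximal
    ⟨A y, y, hy, subset_rfl, rfl⟩
  obtain ⟨⟨v, hv, hyv, rfl⟩, hmax⟩ := hB
  refine ⟨v, ⟨hv, fun w hw hvw => ?_⟩, hyv⟩
  rcases isEmpty_or_nonempty (Facet P) with hE | ⟨⟨F₁⟩⟩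
  · have : P = Set.univ := by
      ext x
      simp [hP.mem_iff]
    have := HypSpace.subsingleton_of_isCompact_univ (this ▸ hP.isCompact)
    exact Subsingleton.elim _ _
  by_contra hne
  -- The direction `d` is not timelike, so the ray from `v` along `d` must leave the cone. At the
  -- first exit it meets a new facet and keeps the old ones, against maximality.
  set d := v.vec - w.vec with hd
  have hd0 : d ≠ 0 := fun h => hne (HypSpace.ext (sub_eq_zero.mp h).symm)
  have hself : 0 ≤ lform d d := by
    rw [hd, lform_sub_left, lform_sub_right, lform_sub_right, v.lform_self, w.lform_self,
      lform_comm w.vec]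
    linarith [lform_neg_of_time_pos v w]
  have hex : {F : Facet P | 0 < lform d F.normal}.Nonempty := by
    by_contra hc
    rw [Set.not_nonempty_iff_eq_empty, Set.eq_empty_iff_forall_notMem] at hc
    exact hself.not_gt (hP.timelike F₁ (fun G => not_lt.mp (hc G)) hd0).1
  obtain ⟨F₀, hF₀, hmin⟩ := Set.exists_min_image _
    (fun F : Facet P => -lform v.vec F.normal / lform d F.normal) (Set.toFinite _) hex
  have hF₀' : 0 < lform d F₀.normal := hF₀
  set t := -lform v.vec F₀.normal / lform d F₀.normal with ht
  have ht0 : 0 ≤ t := div_nonneg (neg_nonneg.mpr (F₀.outward v hv)) hF₀'.le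
  have hz : ∀ F : Facet P, lform (v.vec + t • d) F.normal ≤ 0 := by
    intro F
    rw [lform_add_left, lform_smul_left]
    have h1 := F.outward v hv
    by_cases h : 0 < lform d F.normal
    · have := hmin F h
      rw [le_div_iff₀ h] at this
      linarith
    · push Not at h
      nlinarith [mul_nonneg ht0 (neg_nonneg.mpr h)]
  have hz0 : v.vec + t • d ≠ 0 := by
    intro h
    have h1 : (1 + t) • v.vec = t • w.vec := by
      rw [← sub_eq_zero, ← h, hd]; module
    have h2 : lform ((1 + t) • v.vec) ((1 + t) • v.vec) = lform (t • w.vec) (t • w.vec) := by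
      rw [h1]
    simp only [lform_smul_left, lform_smul_right, v.lform_self, w.lform_self] at h2
    nlinarith
  obtain ⟨x, hx, c, hc, hcx⟩ := hP.exists_smul F₁ hz hz0
  have hxF : ∀ F : Facet P, lform (v.vec + t • d) F.normal = 0 → x ∈ F.face := by
    intro F hF
    rw [hcx, lform_smul_left] at hF
    exact ⟨hx, (mul_eq_zero.mp hF).resolve_left hc.ne'⟩
  have hdv : ∀ F : Facet P, v ∈ F.face → lform d F.normal = 0 := fun F hF => by
    rw [hd, lform_sub_left, hF.2, (hvw F hF).2, sub_zero]
  have hsub : A v ⊆ A x := fun F hF => hxF F (by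
    rw [lform_add_left, lform_smul_left, hdv F hF, hF.2, mul_zero, add_zero])
  have h1 : F₀ ∈ A x := hxF F₀ (by
    rw [lform_add_left, lform_smul_left, ht, div_mul_cancel₀ _ hF₀'.ne']; ring)
  exact hF₀'.ne' (hdv F₀ (hmax ⟨x, hx, hyv.trans hsub, rfl⟩ hsub h1))

/-! ### The Coxeter group and Tits' half-space argument -/

open Classical in
/-- The right-angled Coxeter matrix of a polytope. -/
noncomputable def facetMatrix (P : Set (HypSpace n)) : CoxeterMatrix (Facet P) where
  -- The entry `0` encodes infinite order, that is, no relation.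
  M := Matrix.of fun F G => if F = G then 1 else if lform F.normal G.normal = 0 then 2 else 0
  isSymm := by
    ext F G
    simp only [Matrix.transpose_apply, Matrix.of_apply, lform_comm G.normal, eq_comm (a := G)]
  diagonal F := by simp
  off_diagonal F G h := by
    simp only [Matrix.of_apply, if_neg h]
    split_ifs <;> simp

/-- The abstract right-angled Coxeter group of a polytope. -/
abbrev FacetGroup (P : Set (HypSpace n)) : Type := (facetMatrix P).Group

/-- The Coxeter system of a polytope. -/
noncomputable abbrev facetSystem (P : Set (HypSpace n)) :
    CoxeterSystem (facetMatrix P) (FacetGroup P) :=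
  (facetMatrix P).toCoxeterSystem

theorem facetMatrix_of_lform_eq_zero {F G : Facet P} (h : lform F.normal G.normal = 0) :
    facetMatrix P F G = 2 := by
  have hne : F ≠ G := fun h' => by
    rw [h', G.lform_normal] at h
    exact one_ne_zero h
  simp [facetMatrix, hne, h]

theorem facetMatrix_isLiftable {M : Type*} [Monoid M] {f : Facet P → M}
    (h1 : ∀ F, f F * f F = 1)
    (h2 : ∀ F G, lform F.normal G.normal = 0 → f F * f G = f G * f F) :
    (facetMatrix P).IsLiftable f := by
  intro F G
  by_cases hFG : F = G
  · subst hFG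
    rw [(facetMatrix P).diagonal, pow_one, h1]
  by_cases h : lform F.normal G.normal = 0
  · have hG : lform G.normal F.normal = 0 := by rw [lform_comm, h]
    rw [facetMatrix_of_lform_eq_zero h, pow_two]
    calc f F * f G * (f F * f G) = f F * (f G * f F) * f G := by simp only [mul_assoc]
      _ = f F * f F * (f G * f G) := by rw [h2 G F hG]; simp only [mul_assoc]
      _ = 1 := by rw [h1, h1, one_mul]
  · have : facetMatrix P F G = 0 := by simp [facetMatrix, hFG, h]
    rw [this, pow_zero]

theorem facetSystem_simple_comm {F G : Facet P} (h : lform F.normal G.normal = 0) :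
    (facetSystem P).simple F * (facetSystem P).simple G =
      (facetSystem P).simple G * (facetSystem P).simple F := by
  have h1 := (facetSystem P).simple_mul_simple_pow F G
  rw [facetMatrix_of_lform_eq_zero h, pow_two] at h1
  have h2 := eq_inv_of_mul_eq_one_left h1
  rwa [mul_inv_rev, CoxeterSystem.inv_simple, CoxeterSystem.inv_simple] at h2

theorem Facet.gen_smul_vec (F : Facet P) (x : HypSpace n) :
    (F.gen • x).vec = x.vec - (2 * lform x.vec F.normal) • F.normal := rfl

theorem reflectionGroup_ext {g h : reflectionGroup P} (H : ∀ x : HypSpace n, g • x = h • x) :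
    g = h :=
  Subtype.ext (IsometryEquiv.ext H)

theorem Facet.gen_mul_gen (F : Facet P) : F.gen * F.gen = 1 := by
  refine reflectionGroup_ext fun x => HypSpace.ext ?_
  rw [mul_smul, F.gen_smul_vec, F.gen_smul_vec, one_smul, lform_sub_left, lform_smul_left,
    F.lform_normal]
  module

theorem Facet.gen_comm (F G : Facet P) (h : lform F.normal G.normal = 0) :
    F.gen * G.gen = G.gen * F.gen := by
  have h' : lform G.normal F.normal = 0 := by rw [lform_comm, h]
  refine reflectionGroup_ext fun x => HypSpace.ext ?_
  simp only [mul_smul, Facet.gen_smul_vec, lform_sub_left, lform_smul_left, h, h']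
  module

/-- The homomorphism from the abstract Coxeter group onto the reflection group. -/
noncomputable def facetHom (P : Set (HypSpace n)) : FacetGroup P →* reflectionGroup P :=
  (facetSystem P).lift ⟨Facet.gen, facetMatrix_isLiftable Facet.gen_mul_gen Facet.gen_comm⟩

theorem facetHom_simple (F : Facet P) : facetHom P ((facetSystem P).simple F) = F.gen :=
  (facetSystem P).lift_apply_simple _ F

theorem lform_gen_smul (F : Facet P) (y : HypSpace n) (e : Lorentz n) :
    lform (F.gen • y).vec e = lform y.vec e - 2 * lform y.vec F.normal * lform F.normal e := by
  rw [F.gen_smul_vec, lform_sub_left, lform_smul_left]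

theorem lform_gen_smul_self (F : Facet P) (y : HypSpace n) :
    lform (F.gen • y).vec F.normal = -lform y.vec F.normal := by
  rw [lform_gen_smul, F.lform_normal]; ring

theorem facetHom_smul_eq (u : FacetGroup P) (t : Facet P) (x : HypSpace n) :
    facetHom P u • x = t.gen • (facetHom P ((facetSystem P).simple t * u) • x) := by
  rw [← mul_smul, ← facetHom_simple, ← map_mul, CoxeterSystem.simple_mul_simple_cancel_left]

/-- The second clause strengthens the induction for the infinite dihedral pairs. Reflecting in `G`
turns `aF + bG` into `aF + (-2a⟨F, G⟩ - b)G`; since `⟨F, G⟩ ≤ -1` and `b ≤ a`, the new coefficient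
of `G` is at least `a`, so the shape persists with `F` and `G` exchanged. -/
theorem facetGroup_halfSpace_aux
    (hB : ∀ F G : Facet P, F ≠ G → lform F.normal G.normal = 0 ∨ lform F.normal G.normal ≤ -1)
    (k : ℕ) : ∀ u : FacetGroup P, (facetSystem P).length u = k →
    (∀ F, (facetSystem P).length u < (facetSystem P).length ((facetSystem P).simple F * u) →
      ∀ x ∈ P, lform (facetHom P u • x).vec F.normal ≤ 0) ∧
    ∀ F G, F ≠ G → lform F.normal G.normal ≤ -1 →
      (facetSystem P).length u < (facetSystem P).length ((facetSystem P).simple F * u) →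
      ∀ a b : ℝ, b ≤ a → 0 ≤ b → ∀ x ∈ P,
        a * lform (facetHom P u • x).vec F.normal +
          b * lform (facetHom P u • x).vec G.normal ≤ 0 := by
  induction k using Nat.strong_induction_on with
  | _ k ih =>
  rintro u rfl
  have first : ∀ F,
      (facetSystem P).length u < (facetSystem P).length ((facetSystem P).simple F * u) → ∀ x ∈ P,
      lform (facetHom P u • x).vec F.normal ≤ 0 := by
    intro F hF x hx
    by_cases hu : u = 1
    · subst hu
      rw [map_one, one_smul]
      exact F.outward x hx
    obtain ⟨G, hG⟩ := (facetSystem P).exists_leftDescent_of_ne_one hu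
    have hG : (facetSystem P).length ((facetSystem P).simple G * u) < (facetSystem P).length u := hG
    have hGu : (facetSystem P).simple G * ((facetSystem P).simple G * u) = u :=
      CoxeterSystem.simple_mul_simple_cancel_left _ _
    have hne : F ≠ G := fun h => by subst h; omega
    rw [facetHom_smul_eq u G, lform_gen_smul]
    have hsym : lform G.normal F.normal = lform F.normal G.normal := lform_comm _ _
    rcases hB F G hne with h0 | h1
    · rw [hsym, h0, mul_zero, sub_zero]
      refine (ih _ hG _ rfl).1 F ?_ x hx
      -- If `s_F` shortened `s_G u`, commutation would make `s_F u` shorter than `u`.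
      by_contra hc
      have h2 := (facetSystem P).length_simple_mul_ne ((facetSystem P).simple G * u) F
      have h3 : (facetSystem P).simple F * u = (facetSystem P).simple G *
          ((facetSystem P).simple F * ((facetSystem P).simple G * u)) := by
        rw [← mul_assoc, ← mul_assoc, ← facetSystem_simple_comm h0,
          mul_assoc ((facetSystem P).simple F),
          CoxeterSystem.simple_mul_simple_self, mul_one]
      have h4 := (facetSystem P).length_simple_mul
        ((facetSystem P).simple F * ((facetSystem P).simple G * u)) G
      rw [← h3] at h4
      omega
    -- The reflection in `G` sends the normal of `F` to `F - 2⟨F, G⟩G`, whose coefficients fit the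
    -- second clause for `s_G u`.
    · have := (ih _ hG _ rfl).2 G F hne.symm (hsym ▸ h1) (by rw [hGu]; exact hG)
        (-2 * lform F.normal G.normal) 1 (by linarith) zero_le_one x hx
      rw [hsym]
      linarith
  refine ⟨first, fun F G hne hFG hF a b hba hb x hx => ?_⟩
  by_cases hG : (facetSystem P).length ((facetSystem P).simple G * u) < (facetSystem P).length u
  · have hGu : (facetSystem P).simple G * ((facetSystem P).simple G * u) = u :=
      CoxeterSystem.simple_mul_simple_cancel_left _ _
    have hsym : lform G.normal F.normal = lform F.normal G.normal := lform_comm _ _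
    have := (ih _ hG _ rfl).2 G F hne.symm (hsym ▸ hFG) (by rw [hGu]; exact hG)
        (-2 * a * lform F.normal G.normal - b) a (by nlinarith) (by linarith) x hx
    rw [facetHom_smul_eq u G, lform_gen_smul, lform_gen_smul_self, hsym]
    linarith
  · have hG' := (facetSystem P).length_simple_mul_ne u G
    have h1 := first F hF x hx
    have h2 := first G (by omega) x hx
    nlinarith [mul_nonneg (hb.trans hba) (neg_nonneg.mpr h1), mul_nonneg hb (neg_nonneg.mpr h2)]

theorem IsRightAngledPolytope.halfSpace (hP : IsRightAngledPolytope P) {u : FacetGroup P}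
    {F : Facet P}
    (h : (facetSystem P).length ((facetSystem P).simple F * u) < (facetSystem P).length u)
    {x : HypSpace n} (hx : x ∈ P) :
    0 ≤ lform (facetHom P u • x).vec F.normal := by
  have := (facetGroup_halfSpace_aux (fun _ _ => hP.lform_eq_zero_or_le) _
    ((facetSystem P).simple F * u) rfl).1 F
    (by rwa [CoxeterSystem.simple_mul_simple_cancel_left]) x hx
  rw [facetHom_smul_eq u F, lform_gen_smul_self]
  linarith

/-- A nontrivial element has a left descent `F`, so it moves interior points of `P` across the
hyperplane of `F`. -/
theorem IsRightAngledPolytope.facetHom_injective (hP : IsRightAngledPolytope P) :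
    Function.Injective (facetHom P) := by
  rw [injective_iff_map_eq_one]
  intro u hu
  by_contra hne
  obtain ⟨F, hF⟩ := (facetSystem P).exists_leftDescent_of_ne_one hne
  obtain ⟨p, hp⟩ := hP.interior_nonempty
  have h1 := hP.halfSpace hF (interior_subset hp)
  rw [hu, one_smul] at h1
  exact h1.not_gt (F.lform_neg hp)

theorem facetHom_surjective : Function.Surjective (facetHom P) := by
  rintro ⟨g, hg⟩
  have : ∀ g ∈ reflectionGroup P, ∃ u, (facetHom P u : HypSpace n ≃ᵢ HypSpace n) = g := by
    intro g hg
    induction hg using Subgroup.closure_induction with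
    | mem g hg =>
      obtain ⟨F, rfl⟩ := hg
      exact ⟨(facetSystem P).simple F, by rw [facetHom_simple]; rfl⟩
    | one => exact ⟨1, by simp⟩
    | mul g h _ _ hg hh =>
      obtain ⟨u, rfl⟩ := hg
      obtain ⟨v, rfl⟩ := hh
      exact ⟨u * v, by simp⟩
    | inv g _ hg =>
      obtain ⟨u, rfl⟩ := hg
      exact ⟨u⁻¹, by simp⟩
  obtain ⟨u, hu⟩ := this g hg
  exact ⟨u, Subtype.ext hu⟩

/-! ### Fundamental domain, stabilisers and colourings -/

/-- The polytope is a strict fundamental domain, and stabilisers are generated by reflections. -/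
theorem IsRightAngledPolytope.fundamental (hP : IsRightAngledPolytope P) {x : HypSpace n}
    (hx : x ∈ P) (k : ℕ) : ∀ u : FacetGroup P, (facetSystem P).length u = k → facetHom P u • x ∈ P →
      facetHom P u • x = x ∧ u ∈ Subgroup.closure ((facetSystem P).simple '' {F | x ∈ F.face}) := by
  induction k using Nat.strong_induction_on with
  | _ k ih =>
  rintro u rfl hux
  by_cases hu : u = 1
  · subst hu
    exact ⟨by rw [map_one, one_smul], one_mem _⟩
  obtain ⟨F, hF⟩ := (facetSystem P).exists_leftDescent_of_ne_one hu
  -- A left descent `F` puts `ux` on the far side, membership in `P` on the near side; so `s_F`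
  -- fixes `ux` and can be stripped off `u`.
  have h0 : lform (facetHom P u • x).vec F.normal = 0 :=
    le_antisymm (F.outward _ hux) (hP.halfSpace hF hx)
  have h1 : facetHom P ((facetSystem P).simple F * u) • x = facetHom P u • x := by
    rw [map_mul, mul_smul, facetHom_simple]
    refine HypSpace.ext ?_
    rw [F.gen_smul_vec, h0, mul_zero, zero_smul, sub_zero]
  obtain ⟨h2, h3⟩ := ih _ hF _ rfl (h1 ▸ hux)
  rw [h1] at h2
  refine ⟨h2, ?_⟩
  rw [← (facetSystem P).simple_mul_simple_cancel_left (w := u) F]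
  exact mul_mem (Subgroup.subset_closure ⟨F, ⟨hx, h2 ▸ h0⟩, rfl⟩) h3

theorem dist_facetHom_smul (u : FacetGroup P) (x y : HypSpace n) :
    dist (facetHom P u • x) (facetHom P u • y) = dist x y :=
  (facetHom P u : HypSpace n ≃ᵢ HypSpace n).isometry.dist_eq x y

theorem facetHom_smul_of_mem_closure {x : HypSpace n} {u : FacetGroup P}
    (hu : u ∈ Subgroup.closure ((facetSystem P).simple '' {F | x ∈ F.face})) :
    facetHom P u • x = x := by
  induction hu using Subgroup.closure_induction with
  | mem u hu =>
    obtain ⟨F, hF, rfl⟩ := hu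
    have h : lform x.vec F.normal = 0 := hF.2
    refine HypSpace.ext ?_
    rw [facetHom_simple, F.gen_smul_vec, h, mul_zero, zero_smul, sub_zero]
  | one => rw [map_one, one_smul]
  | mul u v _ _ hu hv => rw [map_mul, mul_smul, hv, hu]
  | inv u _ hu => rw [map_inv, inv_smul_eq_iff, hu]

/-- Elements of the stabiliser of a point act on the normals of the facets through it by signs,
and the signs determine their image in any elementary abelian `2`-group. -/
theorem IsRightAngledPolytope.exists_signs (hP : IsRightAngledPolytope P) {x : HypSpace n}
    {V : Type*} [AddCommGroup V] [Module (ZMod 2) V] {col : Facet P → V}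
    {ψ : FacetGroup P →* Multiplicative V}
    (hψ : ∀ F, ψ ((facetSystem P).simple F) = Multiplicative.ofAdd (col F))
    [Fintype {F : Facet P // x ∈ F.face}] {u : FacetGroup P}
    (hu : u ∈ Subgroup.closure ((facetSystem P).simple '' {F | x ∈ F.face})) :
    ∃ c : {F : Facet P // x ∈ F.face} → ℕ,
      (ψ u).toAdd = ∑ F, (c F : ZMod 2) • col F.1 ∧
      ∀ (z : HypSpace n) (F : {F : Facet P // x ∈ F.face}),
        lform (facetHom P u • z).vec F.1.normal = (-1) ^ c F * lform z.vec F.1.normal := by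
  classical
  induction hu using Subgroup.closure_induction with
  | mem u hu =>
    obtain ⟨F, hF, rfl⟩ := hu
    refine ⟨Pi.single ⟨F, hF⟩ 1, ?_, fun z G => ?_⟩
    · rw [hψ, Finset.sum_eq_single ⟨F, hF⟩]
      · simp
      · intro G _ hG
        simp [Pi.single_eq_of_ne hG]
      · simp
    · rw [facetHom_simple]
      by_cases hG : G = ⟨F, hF⟩
      · subst hG
        rw [lform_gen_smul_self, Pi.single_eq_same]; ring
      · rw [lform_gen_smul, Pi.single_eq_of_ne hG, hP.lform_eq_zero_of_mem (F := F) (G := G.1)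
          (fun h => hG (Subtype.ext h.symm)) hF G.2]
        ring
  | one => exact ⟨0, by simp, fun z F => by simp⟩
  | mul u v _ _ hu hv =>
    obtain ⟨c, hc, hc'⟩ := hu
    obtain ⟨d, hd, hd'⟩ := hv
    refine ⟨c + d, ?_, fun z F => ?_⟩
    · rw [map_mul, toAdd_mul, hc, hd, ← Finset.sum_add_distrib]
      simp [add_smul]
    · rw [map_mul, mul_smul, hc', hd', Pi.add_apply, pow_add]; ring
  | inv u _ hu =>
    obtain ⟨c, hc, hc'⟩ := hu
    refine ⟨c, ?_, fun z F => ?_⟩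
    · rw [map_inv, toAdd_inv, hc, ZModModule.neg_eq_self]
    · have := hc' ((facetHom P u)⁻¹ • z) F
      rw [smul_inv_smul] at this
      rw [map_inv, this, ← mul_assoc, ← mul_pow]
      simp

/-- Independence makes every sign trivial. A left descent of `u` would be a facet through `x` whose
sign is nontrivial, as seen on an interior point of `P`. -/
theorem IsRightAngledPolytope.eq_one_of_map_eq_one (hP : IsRightAngledPolytope P)
    {x : HypSpace n} (hx : x ∈ P) {V : Type*} [AddCommGroup V] [Module (ZMod 2) V]
    {col : Facet P → V} {ψ : FacetGroup P →* Multiplicative V}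
    (hψ : ∀ F, ψ ((facetSystem P).simple F) = Multiplicative.ofAdd (col F))
    (hcol : LinearIndependent (ZMod 2) fun F : {F : Facet P // x ∈ F.face} => col F.1)
    {u : FacetGroup P}
    (hu : u ∈ Subgroup.closure ((facetSystem P).simple '' {F | x ∈ F.face}))
    (hu1 : ψ u = 1) : u = 1 := by
  have := hP.finite_facet
  have := Fintype.ofFinite {F : Facet P // x ∈ F.face}
  obtain ⟨c, hc, hc'⟩ := hP.exists_signs hψ hu
  rw [hu1, toAdd_one] at hc
  have hc0 := Fintype.linearIndependent_iff.mp hcol _ hc.symm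
  by_contra hne
  obtain ⟨F, hF⟩ := (facetSystem P).exists_leftDescent_of_ne_one hne
  obtain ⟨p, hp⟩ := hP.interior_nonempty
  have h1 := hP.halfSpace hF hx
  rw [facetHom_smul_of_mem_closure hu] at h1
  have hxF : x ∈ F.face := ⟨hx, le_antisymm (F.outward x hx) h1⟩
  have h2 := hP.halfSpace hF (interior_subset hp)
  have h3 : Even (c ⟨F, hxF⟩) := by
    rw [even_iff_two_dvd]
    exact (ZMod.natCast_eq_zero_iff _ 2).mp (hc0 ⟨F, hxF⟩)
  rw [hc' p ⟨F, hxF⟩, h3.neg_one_pow, one_mul] at h2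
  exact h2.not_gt (F.lform_neg hp)

/-- The homomorphism from the Coxeter group to an elementary abelian `2`-group given by a
colouring. -/
noncomputable def colourHom {V : Type*} [AddCommGroup V] [Module (ZMod 2) V]
    (col : Facet P → V) : FacetGroup P →* Multiplicative V :=
  (facetSystem P).lift ⟨fun F => Multiplicative.ofAdd (col F), facetMatrix_isLiftable
    (fun F => by rw [← ofAdd_add, ZModModule.add_self, ofAdd_zero]) fun F G _ => mul_comm _ _⟩

theorem colourHom_simple {V : Type*} [AddCommGroup V] [Module (ZMod 2) V]
    (col : Facet P → V) (F : Facet P) :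
    colourHom col ((facetSystem P).simple F) = Multiplicative.ofAdd (col F) :=
  (facetSystem P).lift_apply_simple _ F

/-- Colouring the facets by the standard basis of a finite `𝔽₂`-space embeds the stabiliser in that
space. -/
theorem IsRightAngledPolytope.finite_closure (hP : IsRightAngledPolytope P)
    {x : HypSpace n} (hx : x ∈ P) :
    (Subgroup.closure ((facetSystem P).simple '' {F | x ∈ F.face}) :
      Set (FacetGroup P)).Finite := by
  classical
  have := hP.finite_facet
  let col : Facet P → (Facet P → ZMod 2) := fun F => Pi.single F 1
  have hcol : LinearIndependent (ZMod 2) fun F : {F : Facet P // x ∈ F.face} => col F.1 :=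
    (Pi.linearIndependent_single_one (Facet P) (ZMod 2)).comp _ Subtype.val_injective
  have : Finite (Multiplicative (Facet P → ZMod 2)) :=
    inferInstanceAs (Finite (Facet P → ZMod 2))
  have hinj : Function.Injective ((colourHom col).domRestrict
      (Subgroup.closure ((facetSystem P).simple '' {F | x ∈ F.face}))) := by
    rw [injective_iff_map_eq_one]
    rintro ⟨u, hu⟩ hu1
    exact Subtype.ext (hP.eq_one_of_map_eq_one hx (colourHom_simple col) hcol hu hu1)
  exact Set.finite_coe_iff.mp (Finite.of_injective _ hinj)

theorem IsRightAngledPolytope.finite_meeting (hP : IsRightAngledPolytope P) :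
    {u : FacetGroup P | ∃ x ∈ P, facetHom P u • x ∈ P}.Finite := by
  have := hP.finite_facet
  have : ∀ A : Set (Facet P), {u : FacetGroup P | ∃ x ∈ P, A = {F | x ∈ F.face} ∧
      u ∈ Subgroup.closure ((facetSystem P).simple '' A)}.Finite := by
    intro A
    by_cases h : ∃ x ∈ P, A = {F : Facet P | x ∈ F.face}
    · obtain ⟨x, hx, rfl⟩ := h
      exact (hP.finite_closure hx).subset fun u ⟨_, _, _, hu⟩ => hu
    · exact Set.finite_empty.subset fun u ⟨x, hx, hA, _⟩ => h ⟨x, hx, hA⟩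
  refine (Set.finite_iUnion this).subset fun u ⟨x, hx, hux⟩ => ?_
  exact Set.mem_iUnion.mpr ⟨_, x, hx, rfl, (hP.fundamental hx _ u rfl hux).2⟩

/-! ### The tessellation and proper discontinuity -/

theorem IsRightAngledPolytope.exists_local_cover (hP : IsRightAngledPolytope P) {x : HypSpace n}
    (hx : x ∈ P) : ∃ ε : ℝ, 0 < ε ∧ ∀ y ∈ Metric.ball x ε,
      ∃ u : FacetGroup P, facetHom P u • x = x ∧ facetHom P u • y ∈ P := by
  classical
  have := hP.finite_facet
  have := Fintype.ofFinite (Facet P)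
  have h1 : ∀ᶠ y in nhds x, ∀ F ∈ {F : Facet P | x ∉ F.face}, lform y.vec F.normal < 0 := by
    rw [Filter.eventually_all_finite (Set.toFinite _)]
    intro F hF
    have hlt : lform x.vec F.normal < 0 :=
      lt_of_le_of_ne (F.outward x hx) fun h => hF ⟨hx, h⟩
    exact (((continuous_lform_left F.normal).comp continuous_vec).tendsto x).eventually_lt_const
      hlt
  obtain ⟨ε, hε, h⟩ := Metric.eventually_nhds_iff_ball.mp h1
  refine ⟨ε, hε, fun y hy => ?_⟩
  -- Near `x` only the facets through `x` can be violated. They are mutually orthogonal, so each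
  -- reflection corrects one inequality without disturbing the others.
  have key : ∀ T : Finset (Facet P), (∀ F ∈ T, x ∈ F.face) → ∃ u : FacetGroup P,
      facetHom P u • x = x ∧ ∀ F ∈ T, lform (facetHom P u • y).vec F.normal ≤ 0 := by
    intro T
    induction T using Finset.induction_on with
    | empty => exact fun _ => ⟨1, by simp, by simp⟩
    | insert F T hFT ih =>
      intro hT
      have hF := hT F (Finset.mem_insert_self F T)
      obtain ⟨u, hux, hu⟩ := ih fun G hG => hT G (Finset.mem_insert_of_mem hG)
      by_cases hle : lform (facetHom P u • y).vec F.normal ≤ 0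
      · refine ⟨u, hux, fun G hG => ?_⟩
        rcases Finset.mem_insert.mp hG with rfl | hG
        · exact hle
        · exact hu G hG
      · push Not at hle
        have hFx : F.gen • x = x := HypSpace.ext (by
          have h : lform x.vec F.normal = 0 := hF.2
          rw [F.gen_smul_vec, h, mul_zero, zero_smul, sub_zero])
        refine ⟨(facetSystem P).simple F * u, ?_, fun G hG => ?_⟩
        · rw [map_mul, mul_smul, hux, facetHom_simple, hFx]
        · rw [map_mul, mul_smul, facetHom_simple]
          by_cases hGF : G = F
          · rw [hGF, lform_gen_smul_self]; linarith
          · rw [lform_gen_smul, hP.lform_eq_zero_of_mem (Ne.symm hGF) hF (hT G hG), mul_zero,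
              sub_zero]
            exact hu G ((Finset.mem_insert.mp hG).resolve_left hGF)
  obtain ⟨u, hux, hu⟩ := key (Finset.univ.filter fun F => x ∈ F.face) (by simp)
  refine ⟨u, hux, ?_⟩
  rw [hP.mem_iff]
  intro F
  by_cases hF : x ∈ F.face
  · exact hu F (by simp [hF])
  · refine (h _ ?_ F hF).le
    rw [Metric.mem_ball] at hy ⊢
    have := dist_facetHom_smul u y x
    rw [hux] at this
    rwa [this]

/-- A Lebesgue number makes the radius uniform; the elements used range over the finite set of
`finite_meeting`. -/
theorem IsRightAngledPolytope.exists_uniform_cover (hP : IsRightAngledPolytope P) :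
    ∃ δ : ℝ, 0 < δ ∧ ∀ x ∈ P, ∀ y ∈ Metric.ball x δ,
      ∃ u : FacetGroup P, (∃ z ∈ P, facetHom P u • z ∈ P) ∧ facetHom P u • y ∈ P := by
  choose! ε hε h using fun x => hP.exists_local_cover (x := x)
  obtain ⟨δ, hδ, hδ'⟩ := lebesgue_number_lemma_of_metric
    (c := fun x : P => Metric.ball (x : HypSpace n) (ε x)) hP.isCompact
    (fun x => Metric.isOpen_ball)
    (fun x hx => Set.mem_iUnion.mpr ⟨⟨x, hx⟩, Metric.mem_ball_self (hε x hx)⟩)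
  refine ⟨δ, hδ, fun x hx y hy => ?_⟩
  obtain ⟨⟨z, hz⟩, hxz⟩ := hδ' x hx
  obtain ⟨u, huz, huy⟩ := h z hz y (hxz hy)
  exact ⟨u, ⟨z, hz, huz.symm ▸ hz⟩, huy⟩

/-- The translates of the polytope cover hyperbolic space. -/
theorem IsRightAngledPolytope.exists_smul_mem (hP : IsRightAngledPolytope P) (y : HypSpace n) :
    ∃ u : FacetGroup P, facetHom P u • y ∈ P := by
  obtain ⟨δ, hδ, h⟩ := hP.exists_uniform_cover
  -- The union of the tiles contains the `δ`-neighbourhood of each of its points, so it is open and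
  -- closed.
  let U : Set (HypSpace n) := {y | ∃ u : FacetGroup P, facetHom P u • y ∈ P}
  have hU : ∀ y ∈ U, ∀ z, dist z y < δ → z ∈ U := by
    rintro y ⟨u, hu⟩ z hz
    obtain ⟨v, -, hv⟩ := h _ hu (facetHom P u • z) (by
      rw [Metric.mem_ball, dist_facetHom_smul]; exact hz)
    exact ⟨v * u, by rwa [map_mul, mul_smul]⟩
  have hclopen : IsClopen U := by
    constructor
    · refine isClosed_of_closure_subset fun y hy => ?_
      obtain ⟨z, hz, hyz⟩ := Metric.mem_closure_iff.mp hy δ hδ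
      exact hU z hz y hyz
    · exact Metric.isOpen_iff.mpr fun y hy => ⟨δ, hδ, fun z hz => hU y hy z hz⟩
  obtain ⟨p, hp⟩ := hP.interior_nonempty
  have := hclopen.eq_univ ⟨p, 1, by rw [map_one, one_smul]; exact interior_subset hp⟩
  exact (Set.ext_iff.mp this y).mpr trivial

theorem IsRightAngledPolytope.finite_tiles (hP : IsRightAngledPolytope P) {K : Set (HypSpace n)}
    (hK : IsCompact K) : {u : FacetGroup P | ∃ x ∈ P, facetHom P u • x ∈ K}.Finite := by
  obtain ⟨δ, hδ, h⟩ := hP.exists_uniform_cover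
  set T := {u : FacetGroup P | ∃ x ∈ P, facetHom P u • x ∈ P}
  have hT : T.Finite := hP.finite_meeting
  obtain ⟨t, -, ht⟩ := hK.elim_nhds_subcover (fun z => Metric.ball z δ)
    fun z _ => Metric.ball_mem_nhds z hδ
  have hball : ∀ z, {u : FacetGroup P | ∃ x ∈ P,
      facetHom P u • x ∈ Metric.ball z δ}.Finite := by
    intro z
    obtain ⟨v, hv⟩ := hP.exists_smul_mem z
    -- After `v` brings the centre into `P`, some `w` in `T` brings the nearby point `vux` into `P`;
    -- then `wvu` is in `T` too.
    refine (hT.image2 (fun a b => v⁻¹ * a⁻¹ * b) hT).subset ?_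
    rintro u ⟨x, hx, hux⟩
    obtain ⟨w, hw, hw'⟩ := h _ hv (facetHom P v • (facetHom P u • x)) (by
      rw [Metric.mem_ball, dist_facetHom_smul]; exact hux)
    refine ⟨w, hw, w * v * u, ⟨x, hx, ?_⟩, by group⟩
    rwa [map_mul, map_mul, mul_smul, mul_smul]
  refine (t.finite_toSet.biUnion fun z _ => hball z).subset ?_
  rintro u ⟨x, hx, hux⟩
  obtain ⟨z, hz, hzu⟩ := Set.mem_iUnion₂.mp (ht hux)
  exact Set.mem_iUnion₂.mpr ⟨z, hz, x, hx, hzu⟩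

theorem IsRightAngledPolytope.properlyDiscontinuousSMul (hP : IsRightAngledPolytope P) :
    ProperlyDiscontinuousSMul (reflectionGroup P) (HypSpace n) where
  finite_disjoint_inter_image {K L} hK hL := by
    refine (((hP.finite_tiles hL).image2 (fun a b => a * b⁻¹) (hP.finite_tiles hK)).image
      (facetHom P)).subset ?_
    rintro g ⟨_, ⟨y, hy, rfl⟩, hyL⟩
    obtain ⟨u, rfl⟩ := facetHom_surjective g
    obtain ⟨v, hv⟩ := hP.exists_smul_mem y
    refine ⟨u, ⟨u * v⁻¹, ⟨_, hv, ?_⟩, v⁻¹, ⟨_, hv, ?_⟩, by group⟩, rfl⟩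
    · rw [map_mul, map_inv, mul_smul, inv_smul_smul]; exact hyL
    · rw [map_inv, inv_smul_smul]; exact hy

/-! ### Fixed points of isometries of finite order -/

theorem lform_sum_left {ι : Type*} (s : Finset ι) (f : ι → Lorentz n) (y : Lorentz n) :
    lform (∑ i ∈ s, f i) y = ∑ i ∈ s, lform (f i) y :=
  map_sum (lformLin y) f s

/-- An isometry of finite order has a fixed point, the centre of an orbit. -/
theorem HypSpace.exists_fixed_of_isOfFinOrder {g : HypSpace n ≃ᵢ HypSpace n}
    (hg : IsOfFinOrder g) : ∃ x, g x = x := by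
  have hm := hg.orderOf_pos
  set m := orderOf g
  let p : HypSpace n := lift 0
  let S : Lorentz n := ∑ i ∈ Finset.range m, ((g ^ i) p).vec
  have hne : (Finset.range m).Nonempty := Finset.nonempty_range_iff.mpr hm.ne'
  have hneg : ∀ y : HypSpace n, lform S y.vec < 0 := fun y => by
    rw [lform_sum_left]
    exact Finset.sum_neg (fun i _ => by linarith [lform_neg_of_time_pos ((g ^ i) p) y]) hne
  have hS : lform S S < 0 := by
    rw [lform_sum_left]
    exact Finset.sum_neg (fun i _ => by rw [lform_comm]; exact hneg _) hne
  have hS0 : 0 < S.2 := by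
    rw [Prod.snd_sum]
    exact Finset.sum_pos (fun i _ => time_pos _) hne
  -- Invariance of the orbit sum is expressed by its pairings with points, which avoids extending
  -- `g` linearly. At the normalised sum `x` it says that `x` and `gx` are at distance zero.
  have hinv : ∀ y, lform S (g y).vec = lform S y.vec := by
    intro y
    rw [lform_sum_left, lform_sum_left]
    have h1 := Finset.sum_range_succ' (fun i => lform ((g ^ i) p).vec (g y).vec) m
    have h2 := Finset.sum_range_succ (fun i => lform ((g ^ i) p).vec (g y).vec) m
    have h3 : g ^ m = 1 := pow_orderOf_eq_one g
    rw [h3] at h2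
    have h4 : ∀ i, lform ((g ^ (i + 1)) p).vec (g y).vec = lform ((g ^ i) p).vec y.vec := by
      intro i
      rw [pow_succ']
      exact lform_isometry g _ _
    simp only [h4, pow_zero] at h1
    linarith
  obtain ⟨c, hc, hcS⟩ := exists_smul_normalize S hS hS0
  set x := normalize S hS hS0
  have h1 := hinv x
  rw [hcS, lform_smul_left, lform_smul_left] at h1
  have h2 := mul_left_cancel₀ hc.ne' h1
  refine ⟨x, dist_eq_zero.mp ?_⟩
  rw [dist_comm, dist_def, h2, x.lform_self]
  simp

/-! ### Smooth structure on the quotient -/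

/-- The atlas of local inverses of a surjective local homeomorphism from a model space. -/
@[reducible]
noncomputable def localInverseChartedSpace {E Q : Type*} [TopologicalSpace E]
    [TopologicalSpace Q] {f : E → Q} (hf : IsLocalHomeomorph f) (hs : Function.Surjective f) :
    ChartedSpace E Q where
  atlas := {e | Set.EqOn e.symm f e.target}
  chartAt q := (hf (hs q).choose).choose.symm
  mem_chart_source q := by
    have h := (hf (hs q).choose).choose_spec
    have h1 := (hf (hs q).choose).choose.map_source h.1
    rw [← h.2, (hs q).choose_spec] at h1
    exact h1
  chart_mem_atlas q := by
    have h := (hf (hs q).choose).choose_spec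
    intro u _
    exact (congrFun h.2 u).symm

/-- A free and properly discontinuous action by maps that are smooth in the global chart has a
manifold as quotient. -/
theorem quotientIsManifold_of_smooth {G : Type*} [Group G] [MulAction G (HypSpace n)]
    [ProperlyDiscontinuousSMul G (HypSpace n)] [ContinuousConstSMul G (HypSpace n)]
    (hfree : ∀ (g : G) (x : HypSpace n), g • x = x → g = 1)
    (hsmooth : ∀ g : G, ContDiff ℝ ∞ fun u : EuclideanSpace ℝ (Fin n) => (g • lift u).vec.1) :
    QuotientIsManifold n G := by
  have : IsCancelSMul G (HypSpace n) := isCancelSMul_iff_eq_one_of_smul_eq.mpr hfree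
  have hcov := isQuotientCoveringMap_quotientMk_of_properlyDiscontinuousSMul
    (G := G) (E := HypSpace n)
  refine ⟨inferInstance, hfree, hcov, t2Space_of_properlyDiscontinuousSMul_of_t2Space,
    ContinuousConstSMul.secondCountableTopology, ?_⟩
  set f := quotientParam (n := n) G with hfdef
  have hf : IsLocalHomeomorph f :=
    hcov.isCoveringMap.isLocalHomeomorph.comp liftHomeomorph.isLocalHomeomorph
  have hs : Function.Surjective f :=
    Quotient.mk_surjective.comp (liftHomeomorph (n := n)).surjective
  have hact : ∀ (g : G) u, f ((g • lift u).vec.1) = f u := by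
    intro g u
    have h1 : lift (g • lift u).vec.1 = g • lift u := liftHomeomorph.right_inv (g • lift u)
    rw [hfdef, quotientParam, quotientParam, h1]
    exact Quotient.sound (MulAction.mem_orbit (lift u) g)
  let := localInverseChartedSpace hf hs
  have hmf : IsManifold 𝓘(ℝ, EuclideanSpace ℝ (Fin n)) ∞
      (MulAction.orbitRel.Quotient G (HypSpace n)) := by
    refine isManifold_of_contDiffOn _ _ _ fun e e' he he' => ?_
    have he : Set.EqOn e.symm f e.target := he
    have he' : Set.EqOn e'.symm f e'.target := he'
    simp only [modelWithCornersSelf_coe, modelWithCornersSelf_coe_symm, Function.id_comp,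
      Function.comp_id, Set.range_id, Set.inter_univ, Set.preimage_id]
    intro u hu
    rw [OpenPartialHomeomorph.trans_source] at hu
    have hu1 : u ∈ e.target := hu.1
    have hu2 : e.symm u ∈ e'.source := hu.2
    set w := e' (e.symm u) with hw
    have hwt : w ∈ e'.target := e'.map_source hu2
    have hwu : f w = f u := by
      rw [← he' hwt, hw, e'.left_inv hu2, he hu1]
    -- Both charts invert the quotient map, so near `u` the transition map is the action of this `g`
    -- in the global chart.
    obtain ⟨g, hg⟩ : ∃ g : G, g • lift u = lift w := Quotient.exact hwu
    have hgu : (g • lift u).vec.1 = w := by rw [hg]; rfl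
    refine ((hsmooth g).contDiffAt.congr_of_eventuallyEq ?_).contDiffWithinAt
    have h1 : ∀ᶠ y in nhds u, (g • lift y).vec.1 ∈ e'.target :=
      (hsmooth g).continuous.continuousAt.eventually_mem
        (e'.open_target.mem_nhds (by rw [hgu]; exact hwt))
    have h2 : ∀ᶠ y in nhds u, y ∈ e.target := e.open_target.mem_nhds hu1
    filter_upwards [h1, h2] with y hy1 hy2
    rw [OpenPartialHomeomorph.coe_trans, Function.comp_apply, he hy2, ← hact g y, ← he' hy1,
      e'.right_inv hy1]
  refine ⟨inferInstance, hmf, fun u => ?_⟩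
  obtain ⟨e, hue, hef⟩ := hf u
  have hatlas : e.symm ∈ atlas (EuclideanSpace ℝ (Fin n))
      (MulAction.orbitRel.Quotient G (HypSpace n)) := fun y _ => (congrFun hef y).symm
  have hmax := IsManifold.subset_maximalAtlas (I := 𝓘(ℝ, EuclideanSpace ℝ (Fin n)))
    (n := ∞) hatlas
  exact ⟨{ toPartialEquiv := e.toPartialEquiv
           open_source := e.open_source
           open_target := e.open_target
           contMDiffOn_toFun := contMDiffOn_symm_of_mem_maximalAtlas hmax
           contMDiffOn_invFun := contMDiffOn_of_mem_maximalAtlas hmax }, hue,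
    fun y _ => congrFun hef y⟩

theorem contDiff_facetHom_smul_vec (u : FacetGroup P) :
    ContDiff ℝ ∞ fun y : EuclideanSpace ℝ (Fin n) => (facetHom P u • lift y).vec := by
  induction u using (facetSystem P).simple_induction_left with
  | one =>
    simp only [map_one, one_smul, lift]
    refine contDiff_id.prodMk (ContDiff.sqrt ?_ fun y => by positivity)
    exact contDiff_const.add (contDiff_norm_sq ℝ)
  | mul_simple_left u F h =>
    simp only [map_mul, mul_smul, facetHom_simple, Facet.gen_smul_vec]
    have h1 : ContDiff ℝ ∞ fun y : EuclideanSpace ℝ (Fin n) =>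
        lform (facetHom P u • lift y).vec F.normal :=
      (LinearMap.toContinuousLinearMap (lformLin F.normal)).contDiff.comp h
    exact h.sub ((h1.smul contDiff_const).const_smul (2 : ℝ))

/-! ### The kernel of a colouring -/

/-- The kernel of a colouring acts freely. -/
theorem IsRightAngledPolytope.eq_one_of_smul_eq (hP : IsRightAngledPolytope P)
    {V : Type*} [AddCommGroup V] [Module (ZMod 2) V] {col : Facet P → V}
    (hcol : IsColouring P col) {φ : reflectionGroup P →* Multiplicative V}
    (hφ : ∀ F : Facet P, φ F.gen = Multiplicative.ofAdd (col F)) {g : reflectionGroup P}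
    (hg : φ g = 1) {x : HypSpace n} (hx : g • x = x) : g = 1 := by
  obtain ⟨u, rfl⟩ := facetHom_surjective g
  obtain ⟨v, hv⟩ := hP.exists_smul_mem x
  have hfix : facetHom P (v * u * v⁻¹) • (facetHom P v • x) = facetHom P v • x := by
    rw [map_mul, map_mul, map_inv, mul_smul, inv_smul_smul, mul_smul, hx]
  have hmem := (hP.fundamental hv _ (v * u * v⁻¹) rfl (by rw [hfix]; exact hv)).2
  -- Independence is assumed only at vertices; the facets through the translated point all pass
  -- through `w`, so their colours are independent too.
  obtain ⟨w, hw, hvw⟩ := hP.exists_vertex hv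
  have hinj : Function.Injective fun F : {F : Facet P // facetHom P v • x ∈ F.face} =>
      (⟨F.1, hvw F.1 F.2⟩ : {F : Facet P // w ∈ F.face}) := fun F G h =>
    Subtype.ext (congrArg (fun H => H.1) h)
  have hψ : ∀ F, φ.comp (facetHom P) ((facetSystem P).simple F) =
      Multiplicative.ofAdd (col F) := fun F => by
    rw [MonoidHom.comp_apply, facetHom_simple, hφ]
  have hψu : φ.comp (facetHom P) (v * u * v⁻¹) = 1 := by
    rw [map_mul, map_mul, map_inv, mul_inv_cancel_comm]
    exact hg
  have h1 := hP.eq_one_of_map_eq_one hv hψ ((hcol w hw).comp _ hinj) hmem hψu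
  have h2 : u = 1 := conj_eq_one_iff.mp h1
  rw [h2, map_one]

theorem mainTheorem7 (n : ℕ) (P : Set (HypSpace n)) (hP : IsRightAngledPolytope P)
    (V : Type*) [AddCommGroup V] [Module (ZMod 2) V] [Module.Finite (ZMod 2) V]
    (col : Facet P → V) (hcol : IsColouring P col) :
    (∃! φ : reflectionGroup P →* Multiplicative V,
      ∀ F : Facet P, φ F.gen = Multiplicative.ofAdd (col F)) ∧
    ∀ φ : reflectionGroup P →* Multiplicative V,
      (∀ F : Facet P, φ F.gen = Multiplicative.ofAdd (col F)) →
        (∀ g : φ.ker, IsOfFinOrder g → g = 1) ∧ QuotientIsManifold n φ.ker := by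
  constructor
  · let e := MulEquiv.ofBijective (facetHom P) ⟨hP.facetHom_injective, facetHom_surjective⟩
    refine ⟨(colourHom col).comp e.symm.toMonoidHom, fun F => ?_, fun φ hφ => ?_⟩
    · have h1 : e.symm F.gen = (facetSystem P).simple F := by
        rw [MulEquiv.symm_apply_eq]
        exact (facetHom_simple F).symm
      have h2 : (colourHom col).comp e.symm.toMonoidHom F.gen = colourHom col (e.symm F.gen) := rfl
      rw [h2, h1, colourHom_simple]
    · have h1 : φ.comp (facetHom P) = colourHom col := (facetSystem P).ext_simple fun F => by
        rw [MonoidHom.comp_apply, facetHom_simple, hφ, colourHom_simple]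
      refine MonoidHom.ext fun g => ?_
      obtain ⟨u, rfl⟩ := facetHom_surjective g
      have h2 : e.symm (facetHom P u) = u := e.symm_apply_apply u
      have h3 : (colourHom col).comp e.symm.toMonoidHom (facetHom P u) =
        colourHom col (e.symm (facetHom P u)) := rfl
      rw [h3, h2, ← h1]
      rfl
  · intro φ hφ
    have hfree : ∀ (g : φ.ker) (x : HypSpace n), g • x = x → g = 1 := fun g x hx =>
      Subtype.ext (hP.eq_one_of_smul_eq hcol hφ g.2 hx)
    constructor
    · intro g hg
      have h1 : IsOfFinOrder ((g : reflectionGroup P) : HypSpace n ≃ᵢ HypSpace n) :=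
        (reflectionGroup P).subtype.isOfFinOrder (φ.ker.subtype.isOfFinOrder hg)
      obtain ⟨x, hx⟩ := exists_fixed_of_isOfFinOrder h1
      exact hfree g x hx
    · have hpd : ProperlyDiscontinuousSMul φ.ker (HypSpace n) := by
        refine ⟨fun {K L} hK hL => ?_⟩
        exact (hP.properlyDiscontinuousSMul.finite_disjoint_inter_image hK hL).preimage
          (f := fun g : φ.ker => (g : reflectionGroup P)) Subtype.val_injective.injOn
      have hcont : ContinuousConstSMul φ.ker (HypSpace n) :=
        ⟨fun g => ((g : reflectionGroup P) : HypSpace n ≃ᵢ HypSpace n).continuous⟩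
      refine quotientIsManifold_of_smooth hfree fun g => ?_
      obtain ⟨u, hu⟩ := facetHom_surjective (g : reflectionGroup P)
      have h1 := (contDiff_facetHom_smul_vec u).fst
      rw [hu] at h1
      exact h1
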